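/- Let $d\ge 1$ and let $a,\phi:\mathbb R^d\to[0,\infty)$ be bounded, integrable Borel functions with $\int a(x)\,dx=1$ and $\int|x|^l a(x)\,dx<\infty$ for $l=1,\dots,d+1$. For $\alpha\in[0,1]$ put $\psi_\alpha(x)=(1+\alpha|x|^{d+1})^{-1}$, $\psi=\psi_1$, $a_\alpha(x,y)=a(x-y)\psi_\alpha(x)$, and consider the particle system with generator $$(L^\alpha F)(\gamma)=\sum_{x\in\gamma}\int_{\mathbb R^d}a_\alpha(x,y)\exp\Bigl(-\sum_{z\in\gamma\setminus x}\phi(z-y)\Bigr)\bigl[F(\gamma\setminus x\cup y)-F(\gamma)\bigr]dy .$$ Let $\Gamma_*$ be the set of locally finite configurations $\gamma$ in $\mathbb R^d$ (multiple points allowed) with $\sum_{x\in\gamma}\psi(x)<\infty$, with the weakest topology making all maps $\gamma\mapsto\sum_{x\in\gamma}g(x)\psi(x)$, $g\in C_{\rm b}(\mathbb R^d)$, continuous, and its Borel $\sigma$-field. A function $k$ on finite configurations is given by symmetric Borel functions $k^{(n)}$ on $(\mathbb R^d)^n$, $n\ge0$. It is the correlation function $k_\mu$ of a probability measure $\mu$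 on $\Gamma_*$ if $k\ge 0$ and, for each $n$, $k^{(n)}$ is the density of the $n$-th factorial moment measure of $\mu$; $\mu$ belongs to $\mathcal P^{\vartheta}_{\rm exp}$ if moreover $k_\mu^{(n)}\le e^{\vartheta n}$ for all $n$. Let $\|k\|_\vartheta=\sup_n e^{-\vartheta n}\|k^{(n)}\|_{L^\infty}$ and let $\mathcal K_\vartheta$ be the corresponding Banach space; let $\mathcal G_\vartheta$ be the space of all $G$ with $|G|_\vartheta=\sum_n\frac{e^{\vartheta n}}{n!}\|G^{(n)}\|_{L^1}<\infty$; and let $\langle\!\langle k,G\rangle\!\rangle=\sum_n\frac1{n!}\int k^{(n)}G^{(n)}dx_1\cdots dx_n$. With $\lambda$ the Lebesgue–Poisson measure and $(W_yk)(\eta)=\int k(\eta\cup\xi)\prod_{u\in\xi}(e^{-\phi(u-y)}-1)\,\lambda(d\xi)$, set $$(L^{\Delta,\alpha}k)(\eta)=\sum_{y\in\eta}\int a_\alpha(x,y)\,e^{-\sum_{z\in\eta\setminus y}\phi(z-y)}(W_yk)(\eta\setminus y\cup x)\,dx-\sum_{x\in\eta}\int a_\alpha(x,y)\,e^{-\sum_{z\in\eta\setminus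 x}\phi(z-y)}(W_yk)(\eta)\,dy .$$ Let $\vartheta_0\in\mathbb R$, $\mu_0\in\mathcal P^{\vartheta_0}_{\rm exp}$ and $\vartheta_t=\vartheta_0+t$. For each $\alpha\in[0,1]$ let $(\mu^\alpha_t)_{t\ge0}$ be the evolution of states of the model with $\mu_0^\alpha=\mu_0$, that is, $\mu_t^\alpha$ is a probability measure on $\Gamma_*$ whose correlation function $k_t^\alpha$ satisfies $k_t^\alpha(\eta)\le e^{\vartheta_t|\eta|}$, and for every $T>0$ the map $t\mapsto k^\alpha_t\in\mathcal K_{\vartheta_T}$ is continuous on $[0,T)$, continuously differentiable on $(0,T)$, and satisfies $\frac{d}{dt}k_t^\alpha=L^{\Delta,\alpha}k_t^\alpha$ there. Write $\mu_t=\mu_t^0$ and $k_t=k_t^0$. Then, for each $t>0$, $\mu_t^\alpha\Rightarrow\mu_t$ as $\alpha\to0^+$ in the sense of weak convergence of probability measures on $\Gamma_*$. Moreover, there is $\tilde\vartheta_t>\vartheta_t$ such that $\langle\!\langle k_t^\alpha,G\rangle\!\rangle\to\langle\!\langle k_t,G\rangle\!\rangle$ as $\alpha\to0^+$ for every $G\in\mathcal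 G_{\tilde\vartheta_t}$. -/

import Mathlib

open MeasureTheory Filter Set
open scoped Topology ENNReal

namespace RepulsiveJumps

/-- The habitat `ℝ^d` with its Euclidean norm. -/
abbrev Pt (d : ℕ) : Type := EuclideanSpace ℝ (Fin d)

/-- The functions `ψ_α(x) = 1 / (1 + α |x|^{d+1})`. -/
noncomputable def psiA {d : ℕ} (α : ℝ) (x : Pt d) : ℝ := 1 / (1 + α * ‖x‖ ^ (d + 1))

/-- The weight `ψ(x) = 1 / (1 + |x|^{d+1})`. -/
noncomputable def psi {d : ℕ} (x : Pt d) : ℝ := psiA 1 x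

/-! ### Configurations -/

/-- A locally finite configuration of points of `ℝ^d` in which several points may share a location;
`mult x` is the number of points of the configuration located at `x`. -/
structure Config (d : ℕ) where
  mult : Pt d → ℕ
  locallyFinite : ∀ Λ : Set (Pt d), IsCompact Λ → {x | x ∈ Λ ∧ mult x ≠ 0}.Finite

/-- The set `Γ_*` of tempered configurations: those with `Ψ(γ) = ∑_{x ∈ γ} ψ(x) < ∞`. -/
structure TemperedConfig (d : ℕ) extends Config d where
  tempered : Summable fun x => (mult x : ℝ) * psi x

/-- `∑_{x ∈ γ} g(x)`, with points counted according to their multiplicity. -/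
noncomputable def TemperedConfig.sum {d : ℕ} (γ : TemperedConfig d) (g : Pt d → ℝ) : ℝ :=
  ∑' x, (γ.mult x : ℝ) * g x

/-- The weak topology of `Γ_*`: the coarsest one for which all the maps
`γ ↦ ∑_{x ∈ γ} g(x) ψ(x)`, with `g` bounded and continuous, are continuous. -/
noncomputable instance (d : ℕ) : TopologicalSpace (TemperedConfig d) :=
  ⨅ g : BoundedContinuousFunction (Pt d) ℝ,
    TopologicalSpace.induced (fun γ : TemperedConfig d => γ.sum fun x => g x * psi x) inferInstance

noncomputable instance (d : ℕ) : MeasurableSpace (TemperedConfig d) := borel _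

instance (d : ℕ) : BorelSpace (TemperedConfig d) := ⟨rfl⟩

open Classical in
/-- The sum `∑_{x₁ ∈ γ} ∑_{x₂ ∈ γ∖x₁} ⋯ ∑_{xₙ ∈ γ∖{x₁,…,xₙ₋₁}} g(x₁,…,xₙ)` over the configuration
with multiplicities `m`. -/
noncomputable def factorialSum {d : ℕ} :
    (n : ℕ) → (Pt d → ℕ) → ((Fin n → Pt d) → ℝ≥0∞) → ℝ≥0∞
  | 0, _, g => g Fin.elim0
  | n + 1, m, g => ∑' x, (m x : ℝ≥0∞) *
      factorialSum n (Function.update m x (m x - 1)) fun y => g (Fin.cons x y)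

/-! ### Functions of finite configurations, correlation functions -/

/-- A function `k` on finite configurations, given by `k({x₁,…,xₙ}) = k n (x₁,…,xₙ)`. The symmetry
and the measurability of the components are required separately. -/
abbrev FinFun (d : ℕ) : Type := (n : ℕ) → (Fin n → Pt d) → ℝ

/-- `k` is a measurable function of finite configurations. -/
structure IsFinFun {d : ℕ} (k : FinFun d) : Prop where
  measurable : ∀ n, Measurable (k n)
  symm : ∀ n (σ : Equiv.Perm (Fin n)) (x : Fin n → Pt d), k n (x ∘ σ) = k n x

/-- `k` is (a version of) the correlation function of `μ`: for every `n`, the `n`-th correlation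
(factorial moment) measure of `μ` has density `k n` with respect to Lebesgue measure on
`(ℝ^d)^n`. -/
structure IsCorrelationFunction {d : ℕ} (μ : Measure (TemperedConfig d)) (k : FinFun d) : Prop
    extends IsFinFun k where
  nonneg : ∀ n x, 0 ≤ k n x
  density : ∀ (n : ℕ) (g : (Fin n → Pt d) → ℝ≥0∞), Measurable g →
    ∫⁻ γ, factorialSum n γ.mult g ∂μ = ∫⁻ x, g x * ENNReal.ofReal (k n x)

/-- `μ` is a sub-Poissonian state of type at most `e^ϑ`. -/
def IsSubPoissonian {d : ℕ} (ϑ : ℝ) (μ : Measure (TemperedConfig d)) : Prop :=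
  ∃ k : FinFun d, IsCorrelationFunction μ k ∧ ∀ n x, k n x ≤ Real.exp (ϑ * n)

/-- The norm `‖k‖_ϑ = sup_n e^{-ϑ n} ‖k n‖_{L^∞((ℝ^d)^n)}` of the space `𝒦_ϑ`. -/
noncomputable def kNorm {d : ℕ} (ϑ : ℝ) (k : FinFun d) : ℝ≥0∞ :=
  ⨆ n : ℕ, ENNReal.ofReal (Real.exp (-ϑ * n)) * eLpNorm (k n) ∞ volume

/-- The norm `|G|_ϑ = ∑_n (e^{ϑ n} / n!) ‖G n‖_{L^1((ℝ^d)^n)}` of the space `𝒢_ϑ`. -/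
noncomputable def gNorm {d : ℕ} (ϑ : ℝ) (G : FinFun d) : ℝ≥0∞ :=
  ∑' n : ℕ, ENNReal.ofReal (Real.exp (ϑ * n) / (n.factorial : ℝ)) * eLpNorm (G n) 1 volume

/-- `⟨⟨k, G⟩⟩`, the integral of `k G` with respect to the Lebesgue-Poisson measure. -/
noncomputable def pairing {d : ℕ} (k G : FinFun d) : ℝ :=
  ∑' n : ℕ, (1 / (n.factorial : ℝ)) * ∫ x : Fin n → Pt d, k n x * G n x

/-! ### The models -/

/-- The conditions on the jump kernel `a` and the repulsion potential `φ`. -/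
structure ModelAssumptions {d : ℕ} (a φ : Pt d → ℝ) : Prop where
  measurable_a : Measurable a
  measurable_φ : Measurable φ
  nonneg_a : ∀ x, 0 ≤ a x
  nonneg_φ : ∀ x, 0 ≤ φ x
  bounded_a : BddAbove (range a)
  bounded_φ : BddAbove (range φ)
  integrable_φ : Integrable φ
  integrable_a : Integrable a
  integral_a : ∫ x, a x = 1
  moments_a : ∀ l : ℕ, 1 ≤ l → l ≤ d + 1 → Integrable fun x => ‖x‖ ^ l * a x

/-- `(W_y k)(η) = ∫ k(η ∪ ξ) ∏_{u ∈ ξ} (e^{-φ(u - y)} - 1) λ(dξ)` at `η = {x₁,…,xₙ}`, where `λ` is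
the Lebesgue-Poisson measure. -/
noncomputable def W {d : ℕ} (φ : Pt d → ℝ) (k : FinFun d) (y : Pt d) (n : ℕ)
    (x : Fin n → Pt d) : ℝ :=
  ∑' m : ℕ, (1 / (m.factorial : ℝ)) *
    ∫ u : Fin m → Pt d, k (n + m) (Fin.append x u) * ∏ j, (Real.exp (-φ (u j - y)) - 1)

/-- The jump rate `a_α(x, y) = a(x - y) ψ_α(x)` from `x` to `y` in the absence of other
particles. -/
noncomputable def jumpRate {d : ℕ} (a : Pt d → ℝ) (α : ℝ) (x y : Pt d) : ℝ :=
  a (x - y) * psiA α x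

/-- The operator `L^{Δ,α}` which governs the evolution of correlation functions; it is dual to
`(L^α F)(γ) = ∑_{x ∈ γ} ∫ a_α(x,y) exp(-∑_{z ∈ γ∖x} φ(z - y)) [F(γ∖x ∪ y) - F(γ)] dy`
in the sense that `μ(L^α F^θ) = ⟨⟨L^{Δ,α} k_μ, e(θ)⟩⟩` for `F^θ(γ) = ∏_{x ∈ γ} (1 + θ(x))` and
`e(θ)(η) = ∏_{x ∈ η} θ(x)`. -/
noncomputable def LDelta {d : ℕ} (a φ : Pt d → ℝ) (α : ℝ) (k : FinFun d) : FinFun d :=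
  fun n x =>
    (∑ i, ∫ z, jumpRate a α z (x i) * (∏ j ∈ Finset.univ.erase i, Real.exp (-φ (x j - x i))) *
        W φ k (x i) n (Function.update x i z))
    - ∑ i, ∫ y, jumpRate a α (x i) y * (∏ j ∈ Finset.univ.erase i, Real.exp (-φ (x j - y))) *
        W φ k y n x

/-- `(μ_t)_{t ≥ 0}` is the evolution of states of the model with jump rates `a_α`, started at `μ₀`
of type at most `e^{ϑ₀}`: the correlation functions `k_t` of `μ_t` obey `k_t(η) ≤ e^{(ϑ₀ + t)|η|}`
and, for every `T > 0`, the map `t ↦ k_t` is a classical solution of `(d/dt) k_t = L^{Δ,α} k_t` in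
`𝒦_{ϑ₀ + T}` on `[0, T)`. -/
structure IsStateEvolution {d : ℕ} (a φ : Pt d → ℝ) (α ϑ₀ : ℝ)
    (μ₀ : ProbabilityMeasure (TemperedConfig d))
    (μ : ℝ → ProbabilityMeasure (TemperedConfig d)) (k : ℝ → FinFun d) : Prop where
  initial : μ 0 = μ₀
  correlation : ∀ t, 0 ≤ t →
    IsCorrelationFunction (μ t : Measure (TemperedConfig d)) (k t)
  bound : ∀ t, 0 ≤ t → ∀ n x, k t n x ≤ Real.exp ((ϑ₀ + t) * n)
  continuous : ∀ T t, 0 ≤ t → t < T →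
    Tendsto (fun s => kNorm (ϑ₀ + T) (k s - k t)) (𝓝[Ici 0] t) (𝓝 0)
  deriv : ∀ T t, 0 < t → t < T →
    Tendsto (fun h : ℝ => kNorm (ϑ₀ + T) (h⁻¹ • (k (t + h) - k t) - LDelta a φ α (k t)))
      (𝓝[≠] 0) (𝓝 0)
  deriv_continuous : ∀ T t, 0 < t → t < T →
    Tendsto (fun s => kNorm (ϑ₀ + T) (LDelta a φ α (k s) - LDelta a φ α (k t))) (𝓝 t) (𝓝 0)

end RepulsiveJumps

open RepulsiveJumps

namespace RepulsiveJumps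

/-! ### Measure preserving rearrangements of coordinates -/

/-! Integrating the evolution equation against an integrable function `g` of `n` points moves
`L^{Δ,α}` onto `g`. Exchanging the departure and arrival points in the gain term puts `ψ_α` at the
departure point in both gain and loss, and Fubini transposes the Mayer products in `W_y`. The
result, `integral_LDelta_mul`, is a sum over the jumping particle `i` and the number `m` of extra
points of `(1/m!) ∫ k(v) ψ_α(v_i) B(v) dv`, where `B = testOp a φ g i m` is independent of `α`. So
`α` enters only through a multiplier in `[0,1]` tending to 1 pointwise, and dominated convergence
disposes of it.

Let `D` be the difference of the integrals of `g` against `k_t^α` and `k_t^0`. Up to an error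
vanishing with `α`, its time derivative is the series of the same differences for the functions `B`.
As `‖B‖₁ ≤ 2 ‖e^{-φ} - 1‖₁^m ‖g‖₁`, a bound `|D| ≤ c e^{ϑn} ‖g‖₁` for all `n` and `g` gives a
derivative of order `n c e^{ϑn} ‖g‖₁`. The unbounded factor `n` is absorbed, as in Ovsyannikov's
method, by a weight growing in time: `e^{(ϑ+λτ)n}` has derivative `λ n e^{(ϑ+λτ)n}`. For large `λ`
and times `τ ≤ δ ≤ 1/λ`, integration halves `c` (`ApproxBound.halve`). The a priori bounds give `c =
2`, and each halving costs only a smaller range of `α` and an arbitrarily small additive error.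
Hence `D → 0` propagates from the left end of an interval to its right end. The admissible length
depends only on the horizon, so finitely many steps reach `t`; dominated convergence over `n` then
gives convergence of the pairings.

For the states, the topology of `Γ_*` is induced by a map `cubeMap` into a compact cube with
countably many coordinates of the form `exp(-∑ f_i ψ)`. By Stone-Weierstrass, convergence of the
image measures follows from that of the Laplace functionals `∫ exp(-∑ g ψ) dμ`, `g ≥ 0`; the
open-set form of the portmanteau theorem pulls this back to `Γ_*` without a tightness argument. If
`g` has compact support, its Laplace functional is the pairing of the correlation function with `∏
(e^{-gψ} - 1)`. For general `g` a cutoff error is controlled by the first correlation function,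
uniformly in `α`. -/

theorem measurable_finAppend {X : Type*} [MeasurableSpace X] (n m : ℕ) :
    Measurable fun p : (Fin n → X) × (Fin m → X) => Fin.append p.1 p.2 := by
  refine measurable_pi_lambda _ fun j => ?_
  refine Fin.addCases (fun i => ?_) (fun i => ?_) j
  · simp only [Fin.append_left]; fun_prop
  · simp only [Fin.append_right]; fun_prop

theorem measurePreserving_finAppend (X : Type*) [MeasureSpace X]
    [SigmaFinite (volume : Measure X)] (n m : ℕ) :
    MeasurePreserving (fun p : (Fin n → X) × (Fin m → X) => Fin.append p.1 p.2)
      (volume.prod volume) volume := by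
  refine ⟨measurable_finAppend n m, (Measure.pi_eq fun s hs => ?_).symm⟩
  rw [Measure.map_apply (measurable_finAppend n m) (MeasurableSet.univ_pi hs)]
  have : (fun p : (Fin n → X) × (Fin m → X) => Fin.append p.1 p.2) ⁻¹' univ.pi s
      = (univ.pi fun i => s (Fin.castAdd m i)) ×ˢ (univ.pi fun i => s (Fin.natAdd n i)) := by
    ext p
    simp only [mem_preimage, Set.mem_pi, mem_univ, true_implies, mem_prod]
    constructor
    · intro h
      exact ⟨fun i => by simpa using h (Fin.castAdd m i), fun i => by simpa using h (Fin.natAdd n i)⟩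
    · rintro ⟨h₁, h₂⟩ j
      exact Fin.addCases (fun i => by simpa using h₁ i) (fun i => by simpa using h₂ i) j
  rw [this, Measure.prod_prod, volume_pi, volume_pi, Measure.pi_pi, Measure.pi_pi,
    Fin.prod_univ_add]

/-- The exchange of the `i`-th coordinate of `x` with `y`. -/
def exchange {X : Type*} {n : ℕ} (i : Fin n) (p : (Fin n → X) × X) : (Fin n → X) × X :=
  (Function.update p.1 i p.2, p.1 i)

theorem exchange_exchange {X : Type*} {n : ℕ} (i : Fin n) (p : (Fin n → X) × X) :
    exchange i (exchange i p) = p := by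
  simp [exchange]

theorem measurePreserving_exchange (X : Type*) [MeasureSpace X]
    [SigmaFinite (volume : Measure X)] {n : ℕ} (i : Fin n) :
    MeasurePreserving (exchange (X := X) i) (volume.prod volume) (volume.prod volume) := by
  have h₁ := volume_preserving_piFinSuccAbove (fun _ : Fin (n + 1) => X) (Fin.last n)
  have h₂ := volume_measurePreserving_piCongrLeft (fun _ : Fin (n + 1) => X)
    (Equiv.swap i.castSucc (Fin.last n))
  have h₃ : MeasurePreserving (Prod.swap : X × (Fin n → X) → _) (volume.prod volume)
    (volume.prod volume) := Measure.measurePreserving_swap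
  have h₄ : MeasurePreserving (Prod.swap : (Fin n → X) × X → _) (volume.prod volume)
    (volume.prod volume) := Measure.measurePreserving_swap
  -- Append `y` as a last coordinate, apply the transposition of coordinate `i` with the last one,
  -- and split the last coordinate off again.
  have h := h₃.comp (h₁.comp (h₂.comp ((MeasurePreserving.symm _ h₁).comp h₄)))
  convert h using 1
  funext p
  obtain ⟨x, y⟩ := p
  have key : ∀ j : Fin (n + 1), (MeasurableEquiv.piCongrLeft (fun _ : Fin (n + 1) => X)
      (Equiv.swap i.castSucc (Fin.last n))) (Fin.snoc (α := fun _ => X) x y) j =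
      (Fin.snoc (α := fun _ => X) x y : Fin (n + 1) → X)
        (Equiv.swap i.castSucc (Fin.last n) j) := by
    intro j
    obtain ⟨j, rfl⟩ := (Equiv.swap i.castSucc (Fin.last n)).surjective j
    simp [MeasurableEquiv.piCongrLeft]
  simp only [exchange, Function.comp_apply, Prod.swap, MeasurableEquiv.piFinSuccAbove_symm_apply,
    show Fin.insertNthEquiv (fun _ : Fin (n + 1) => X) (Fin.last n) (y, x)
      = Fin.snoc (α := fun _ => X) x y from Fin.insertNth_last' y x]
  refine Prod.ext ?_ ?_
  · funext j
    change _ = (MeasurableEquiv.piCongrLeft (fun _ : Fin (n + 1) => X)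
      (Equiv.swap i.castSucc (Fin.last n))) (Fin.snoc (α := fun _ => X) x y)
        ((Fin.last n).succAbove j)
    rw [key, Fin.succAbove_last]
    by_cases hj : j = i
    · subst hj; simp
    · rw [Equiv.swap_apply_of_ne_of_ne (by simpa using hj) (Fin.castSucc_lt_last j).ne]
      simp [hj]
  · change _ = (MeasurableEquiv.piCongrLeft (fun _ : Fin (n + 1) => X)
      (Equiv.swap i.castSucc (Fin.last n))) (Fin.snoc (α := fun _ => X) x y) (Fin.last n)
    rw [key]; simp

theorem measurePreserving_prodProdComm (α β γ : Type*) [MeasureSpace α] [MeasureSpace β]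
    [MeasureSpace γ] [SFinite (volume : Measure α)] [SFinite (volume : Measure β)]
    [SFinite (volume : Measure γ)] :
    MeasurePreserving (fun p : (α × β) × γ => ((p.1.1, p.2), p.1.2))
      ((volume.prod volume).prod volume) ((volume.prod volume).prod volume) := by
  have h₁ := measurePreserving_prodAssoc (volume : Measure α) (volume : Measure β)
    (volume : Measure γ)
  have h₂ := measurePreserving_prodAssoc (volume : Measure α) (volume : Measure γ)
    (volume : Measure β)
  exact (MeasurePreserving.symm _ h₂).comp
    (((MeasurePreserving.id (volume : Measure α)).prod Measure.measurePreserving_swap).comp h₁)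

theorem integral_comp_of_measurePreserving {α β : Type*} [MeasurableSpace α] [MeasurableSpace β]
    {μ : Measure α} {ν : Measure β} {f : α → β} (hf : MeasurePreserving f μ ν) {F : β → ℝ}
    (hF : AEStronglyMeasurable F ν) : ∫ a, F (f a) ∂μ = ∫ b, F b ∂ν := by
  have hF' : AEStronglyMeasurable F (μ.map f) := by rwa [hf.map_eq]
  rw [← hf.map_eq, integral_map hf.measurable.aemeasurable hF']

/-! ### Mayer factors -/

/-- The product `∏_{u ∈ ξ} (e^{-φ(u - y)} - 1)`. -/
noncomputable def mayer {d : ℕ} (φ : Pt d → ℝ) (y : Pt d) {m : ℕ} (u : Fin m → Pt d) : ℝ :=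
  ∏ j, (Real.exp (-φ (u j - y)) - 1)

/-- The integral of `|e^{-φ} - 1|`. -/
noncomputable def mayerNorm {d : ℕ} (φ : Pt d → ℝ) : ℝ := ∫ u, |Real.exp (-φ u) - 1|

theorem mayerNorm_nonneg {d : ℕ} (φ : Pt d → ℝ) : 0 ≤ mayerNorm φ :=
  integral_nonneg fun _ => abs_nonneg _

section Mayer

variable {d : ℕ} {a φ : Pt d → ℝ}

theorem ModelAssumptions.integrable_exp_sub_one (h : ModelAssumptions a φ) :
    Integrable fun u => Real.exp (-φ u) - 1 := by
  have := h.measurable_φ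
  refine h.integrable_φ.mono' (by fun_prop) (ae_of_all _ fun u => ?_)
  have h₁ := Real.one_sub_le_exp_neg (φ u)
  have h₂ : Real.exp (-φ u) ≤ 1 := Real.exp_le_one_iff.2 (by linarith [h.nonneg_φ u])
  rw [Real.norm_eq_abs, abs_le]
  constructor <;> linarith

theorem ModelAssumptions.measurable_mayer (h : ModelAssumptions a φ) {α : Type*}
    [MeasurableSpace α] {m : ℕ} {f : α → Pt d} {g : α → Fin m → Pt d} (hf : Measurable f)
    (hg : Measurable g) : Measurable fun p => mayer φ (f p) (g p) := by
  have := h.measurable_φ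
  unfold mayer
  refine Finset.measurable_fun_prod _ fun j _ => ?_
  fun_prop

theorem ModelAssumptions.integrable_mayer (h : ModelAssumptions a φ) (y : Pt d) (m : ℕ) :
    Integrable fun u : Fin m → Pt d => mayer φ y u :=
  Integrable.fintype_prod fun _ => h.integrable_exp_sub_one.comp_sub_right y

theorem integral_abs_mayer (φ : Pt d → ℝ) (y : Pt d) (m : ℕ) :
    ∫ u : Fin m → Pt d, |mayer φ y u| = mayerNorm φ ^ m := by
  simp only [mayer, Finset.abs_prod]
  rw [integral_fintype_prod_volume_eq_pow (fun v : Pt d => |Real.exp (-φ (v - y)) - 1|),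
    integral_sub_right_eq_self (fun v : Pt d => |Real.exp (-φ v) - 1|) y, Fintype.card_fin]
  rfl

theorem ModelAssumptions.integrable_mul_mayer (h : ModelAssumptions a φ) {n : ℕ}
    {H : (Fin n → Pt d) × Pt d → ℝ} (hH : Integrable H (volume.prod volume)) (m : ℕ) :
    Integrable (fun q : ((Fin n → Pt d) × Pt d) × (Fin m → Pt d) => H q.1 * mayer φ q.1.2 q.2)
      ((volume.prod volume).prod volume) := by
  have hM : Measurable fun q : ((Fin n → Pt d) × Pt d) × (Fin m → Pt d) => mayer φ q.1.2 q.2 :=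
    h.measurable_mayer (measurable_snd.comp measurable_fst) measurable_snd
  have hHM : AEStronglyMeasurable (fun q : ((Fin n → Pt d) × Pt d) × (Fin m → Pt d) =>
      H q.1 * mayer φ q.1.2 q.2) ((volume.prod volume).prod volume) :=
    hH.aestronglyMeasurable.comp_fst.mul hM.aestronglyMeasurable
  refine (integrable_prod_iff hHM).2 ⟨ae_of_all _ fun p => (h.integrable_mayer p.2 m).const_mul (H p), ?_⟩
  simp only [norm_mul, integral_const_mul]
  simp only [Real.norm_eq_abs, integral_abs_mayer]
  exact hH.abs.mul_const _

theorem integral_abs_mul_mayer (h : ModelAssumptions a φ) {n : ℕ}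
    {H : (Fin n → Pt d) × Pt d → ℝ} (hH : Integrable H (volume.prod volume)) (m : ℕ) :
    ∫ q : ((Fin n → Pt d) × Pt d) × (Fin m → Pt d), |H q.1 * mayer φ q.1.2 q.2|
        ∂((volume.prod volume).prod volume)
      = mayerNorm φ ^ m * ∫ p, |H p| ∂(volume.prod volume) := by
  rw [integral_prod _ (h.integrable_mul_mayer hH m).abs]
  simp only [abs_mul, integral_const_mul, integral_abs_mayer]
  rw [integral_mul_const, mul_comm]

/-- The function `(x, u) ↦ ∫ H(x, y) ∏_{v ∈ u} (e^{-φ(v - y)} - 1) dy`. -/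
noncomputable def mayerLift (φ : Pt d → ℝ) {n : ℕ} (H : (Fin n → Pt d) × Pt d → ℝ) (m : ℕ)
    (v : Fin (n + m) → Pt d) : ℝ :=
  ∫ y, H (fun i => v (Fin.castAdd m i), y) * mayer φ y fun j => v (Fin.natAdd n j)

theorem mayerLift_append (φ : Pt d → ℝ) {n m : ℕ} (H : (Fin n → Pt d) × Pt d → ℝ)
    (x : Fin n → Pt d) (u : Fin m → Pt d) :
    mayerLift φ H m (Fin.append x u) = ∫ y, H (x, y) * mayer φ y u := by
  simp [mayerLift]

theorem ModelAssumptions.measurable_mayerLift (h : ModelAssumptions a φ) {n : ℕ}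
    {H : (Fin n → Pt d) × Pt d → ℝ} (hH : Measurable H) (m : ℕ) :
    Measurable (mayerLift φ H m) := by
  refine (StronglyMeasurable.integral_prod_right (f := fun (v : Fin (n + m) → Pt d) y =>
    H (fun i => v (Fin.castAdd m i), y) * mayer φ y fun j => v (Fin.natAdd n j))
    (Measurable.stronglyMeasurable ?_)).measurable
  refine (hH.comp (f := fun p : (Fin (n + m) → Pt d) × Pt d =>
    (fun i => p.1 (Fin.castAdd m i), p.2)) ?_).mul (h.measurable_mayer ?_ ?_)
  · fun_prop
  · fun_prop
  · fun_prop

theorem ModelAssumptions.integrable_mayerLift_aux (h : ModelAssumptions a φ) {n : ℕ}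
    {H : (Fin n → Pt d) × Pt d → ℝ} (hH : Integrable H (volume.prod volume)) (m : ℕ) :
    Integrable (fun q : ((Fin n → Pt d) × (Fin m → Pt d)) × Pt d => H (q.1.1, q.2) *
      mayer φ q.2 q.1.2) ((volume.prod volume).prod volume) :=
  (measurePreserving_prodProdComm (Fin n → Pt d) (Fin m → Pt d) (Pt d)).integrable_comp_of_integrable
    (h.integrable_mul_mayer hH m)

theorem ModelAssumptions.integrable_mayerLift (h : ModelAssumptions a φ) {n : ℕ}
    {H : (Fin n → Pt d) × Pt d → ℝ} (hH : Measurable H)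
    (hHi : Integrable H (volume.prod volume)) (m : ℕ) :
    Integrable (mayerLift φ H m) := by
  refine ((measurePreserving_finAppend (Pt d) n m).integrable_comp
    (h.measurable_mayerLift hH m).aestronglyMeasurable).1 ?_
  refine (h.integrable_mayerLift_aux hHi m).integral_prod_left.congr (ae_of_all _ fun p => ?_)
  simp [mayerLift_append]

theorem ModelAssumptions.integral_abs_mayerLift_le (h : ModelAssumptions a φ) {n : ℕ}
    {H : (Fin n → Pt d) × Pt d → ℝ} (hH : Measurable H)
    (hHi : Integrable H (volume.prod volume)) (m : ℕ) :
    ∫ v, |mayerLift φ H m v| ≤ mayerNorm φ ^ m * ∫ p, |H p| ∂(volume.prod volume) := by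
  have hi := h.integrable_mayerLift_aux hHi m
  rw [← integral_comp_of_measurePreserving (measurePreserving_finAppend (Pt d) n m)
    (h.measurable_mayerLift hH m).abs.aestronglyMeasurable, ← integral_abs_mul_mayer h hHi m,
    ← integral_comp_of_measurePreserving
      (measurePreserving_prodProdComm (Fin n → Pt d) (Fin m → Pt d) (Pt d))
      (h.integrable_mul_mayer hHi m).abs.aestronglyMeasurable, integral_prod _ hi.abs]
  refine integral_mono_of_nonneg (ae_of_all _ fun _ => abs_nonneg _) hi.abs.integral_prod_left
    (ae_of_all _ fun p => ?_)
  simp only [mayerLift_append]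
  exact abs_integral_le_integral_abs

/-! ### Integrals against `W_y k` -/

/-- `k` is a measurable function of finite configurations with `|k(η)| ≤ e^{ϑ|η|}`. -/
structure IsBoundedFun (ϑ : ℝ) (k : FinFun d) : Prop where
  measurable : ∀ n, Measurable (k n)
  abs_le : ∀ n x, |k n x| ≤ Real.exp (ϑ * n)

theorem IsBoundedFun.measurable_append {ϑ : ℝ} {k : FinFun d} (hk : IsBoundedFun ϑ k) {α : Type*}
    [MeasurableSpace α] {n m : ℕ} {f : α → Fin n → Pt d} {g : α → Fin m → Pt d}
    (hf : Measurable f) (hg : Measurable g) :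
    Measurable fun p => k (n + m) (Fin.append (f p) (g p)) := by
  have h₁ := measurable_finAppend (X := Pt d) n m
  have h₂ := hf.prodMk hg
  exact (hk.measurable (n + m)).comp (h₁.comp h₂)

/-- The `m`-th term in the series for `W_y k`. -/
noncomputable def WTerm (φ : Pt d → ℝ) (k : FinFun d) {n : ℕ} (m : ℕ)
    (p : (Fin n → Pt d) × Pt d) : ℝ :=
  (1 / (m.factorial : ℝ)) * ∫ u : Fin m → Pt d, k (n + m) (Fin.append p.1 u) * mayer φ p.2 u

variable {ϑ : ℝ} {k : FinFun d}

theorem measurable_WTerm (h : ModelAssumptions a φ) (hk : IsBoundedFun ϑ k) (n m : ℕ) :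
    Measurable (WTerm φ k (n := n) m) := by
  refine (StronglyMeasurable.integral_prod_right (f := fun (p : (Fin n → Pt d) × Pt d)
    (u : Fin m → Pt d) => k (n + m) (Fin.append p.1 u) * mayer φ p.2 u)
    (Measurable.stronglyMeasurable ?_)).measurable.const_mul _
  exact (hk.measurable_append (measurable_fst.comp measurable_fst) measurable_snd).mul
    (h.measurable_mayer (measurable_snd.comp measurable_fst) measurable_snd)

/-- The bound for the `m`-th term in the series for `W_y k`. -/
noncomputable def WBound (φ : Pt d → ℝ) (ϑ : ℝ) (n m : ℕ) : ℝ :=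
  Real.exp (ϑ * n) * ((Real.exp ϑ * mayerNorm φ) ^ m / m.factorial)

theorem hasSum_WBound (φ : Pt d → ℝ) (ϑ : ℝ) (n : ℕ) :
    HasSum (WBound φ ϑ n) (Real.exp (ϑ * n) * Real.exp (Real.exp ϑ * mayerNorm φ)) := by
  refine HasSum.mul_left _ ?_
  rw [Real.exp_eq_exp_ℝ]
  exact NormedSpace.expSeries_div_hasSum_exp _

theorem WBound_eq (φ : Pt d → ℝ) (ϑ : ℝ) (n m : ℕ) :
    WBound φ ϑ n m = (1 / (m.factorial : ℝ)) *
      (Real.exp (ϑ * (n + m : ℕ)) * mayerNorm φ ^ m) := by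
  rw [WBound, Nat.cast_add, mul_add, Real.exp_add, mul_pow, ← Real.exp_nat_mul, mul_comm (m : ℝ) ϑ]
  ring

theorem abs_WTerm_le (h : ModelAssumptions a φ) (hk : IsBoundedFun ϑ k) {n : ℕ} (m : ℕ)
    (p : (Fin n → Pt d) × Pt d) : |WTerm φ k m p| ≤ WBound φ ϑ n m := by
  rw [WTerm, abs_mul, abs_of_nonneg (by positivity), WBound_eq]
  gcongr
  calc |∫ u : Fin m → Pt d, k (n + m) (Fin.append p.1 u) * mayer φ p.2 u|
      ≤ ∫ u : Fin m → Pt d, Real.exp (ϑ * (n + m : ℕ)) * |mayer φ p.2 u| := by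
        refine abs_integral_le_integral_abs.trans (integral_mono_of_nonneg
          (ae_of_all _ fun _ => abs_nonneg _) ((h.integrable_mayer p.2 m).abs.const_mul _)
          (ae_of_all _ fun u => ?_))
        simp only [abs_mul]
        gcongr
        exact hk.abs_le _ _
    _ = _ := by rw [integral_const_mul, integral_abs_mayer]

theorem W_eq_tsum_WTerm (φ : Pt d → ℝ) (k : FinFun d) {n : ℕ} (p : (Fin n → Pt d) × Pt d) :
    W φ k p.2 n p.1 = ∑' m, WTerm φ k m p := rfl

/-- Transposition of `W_y` by Fubini: boundedness of `k` makes the integrand jointly integrable in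
`(x, y, u)`, so `y` can be integrated first and `k` no longer meets it. -/
theorem integral_mul_WTerm (h : ModelAssumptions a φ) (hk : IsBoundedFun ϑ k) {n : ℕ}
    {H : (Fin n → Pt d) × Pt d → ℝ} (hH : Measurable H)
    (hHi : Integrable H (volume.prod volume)) (m : ℕ) :
    ∫ p, H p * WTerm φ k m p ∂(volume.prod volume)
      = (1 / (m.factorial : ℝ)) * ∫ v, k (n + m) v * mayerLift φ H m v := by
  have hkm : Measurable fun q : ((Fin n → Pt d) × Pt d) × (Fin m → Pt d) =>
      k (n + m) (Fin.append q.1.1 q.2) :=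
    hk.measurable_append (measurable_fst.comp measurable_fst) measurable_snd
  have h₁ : Integrable (fun q : ((Fin n → Pt d) × Pt d) × (Fin m → Pt d) =>
      k (n + m) (Fin.append q.1.1 q.2) * (H q.1 * mayer φ q.1.2 q.2))
      ((volume.prod volume).prod volume) :=
    (h.integrable_mul_mayer hHi m).bdd_mul (c := Real.exp (ϑ * (n + m : ℕ)))
      hkm.aestronglyMeasurable (ae_of_all _ fun q => hk.abs_le _ _)
  have h₂ := (measurePreserving_prodProdComm (Fin n → Pt d) (Fin m → Pt d)
    (Pt d)).integrable_comp_of_integrable h₁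
  calc ∫ p, H p * WTerm φ k m p ∂(volume.prod volume)
      = (1 / (m.factorial : ℝ)) * ∫ p : (Fin n → Pt d) × Pt d, (∫ u : Fin m → Pt d,
          k (n + m) (Fin.append p.1 u) * (H p * mayer φ p.2 u)) ∂(volume.prod volume) := by
        rw [← integral_const_mul]
        refine integral_congr_ae (ae_of_all _ fun p => ?_)
        simp only [WTerm]
        rw [mul_left_comm, ← integral_const_mul]
        simp only [mul_left_comm (H p)]
    _ = (1 / (m.factorial : ℝ)) * ∫ q : ((Fin n → Pt d) × Pt d) × (Fin m → Pt d),
          k (n + m) (Fin.append q.1.1 q.2) * (H q.1 * mayer φ q.1.2 q.2)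
            ∂((volume.prod volume).prod volume) := by rw [integral_prod _ h₁]
    _ = (1 / (m.factorial : ℝ)) * ∫ p : (Fin n → Pt d) × (Fin m → Pt d),
          k (n + m) (Fin.append p.1 p.2) * mayerLift φ H m (Fin.append p.1 p.2)
            ∂(volume.prod volume) := by
        rw [← integral_comp_of_measurePreserving (measurePreserving_prodProdComm (Fin n → Pt d)
          (Fin m → Pt d) (Pt d)) h₁.aestronglyMeasurable]
        refine congrArg _ ((integral_prod _ h₂).trans ?_)
        simp only [Function.comp_apply, mayerLift_append, integral_const_mul]
    _ = _ := by
        rw [integral_comp_of_measurePreserving (measurePreserving_finAppend (Pt d) n m)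
          (F := fun v => k (n + m) v * mayerLift φ H m v)
          ((hk.measurable _).mul (h.measurable_mayerLift hH m)).aestronglyMeasurable]

/-- The series for `W_y k` is bounded uniformly in `x` and `y` by `e^{ϑn} exp(e^ϑ ‖e^{-φ} - 1‖₁)`,
since translating `φ` by `y` does not change the `L^1` norm of a Mayer factor. -/
theorem integrable_mul_W (h : ModelAssumptions a φ) (hk : IsBoundedFun ϑ k) {n : ℕ}
    {H : (Fin n → Pt d) × Pt d → ℝ} (hHi : Integrable H (volume.prod volume)) :
    Integrable (fun p => H p * W φ k p.2 n p.1) (volume.prod volume) := by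
  have hW : Measurable fun p : (Fin n → Pt d) × Pt d => W φ k p.2 n p.1 := by
    simp only [W_eq_tsum_WTerm]
    exact Measurable.tsum fun m => measurable_WTerm h hk n m
  refine hHi.mul_bdd (c := Real.exp (ϑ * n) * Real.exp (Real.exp ϑ * mayerNorm φ))
    hW.aestronglyMeasurable (ae_of_all _ fun p => ?_)
  rw [W_eq_tsum_WTerm]
  exact tsum_of_norm_bounded (hasSum_WBound φ ϑ n) fun m => abs_WTerm_le h hk m p

theorem hasSum_integral_mul_W (h : ModelAssumptions a φ) (hk : IsBoundedFun ϑ k) {n : ℕ}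
    {H : (Fin n → Pt d) × Pt d → ℝ} (hH : Measurable H)
    (hHi : Integrable H (volume.prod volume)) :
    HasSum (fun m : ℕ => (1 / (m.factorial : ℝ)) * ∫ v, k (n + m) v * mayerLift φ H m v)
      (∫ p, H p * W φ k p.2 n p.1 ∂(volume.prod volume)) := by
  have hi : ∀ m, Integrable (fun p => H p * WTerm φ k m p) (volume.prod volume) := fun m =>
    hHi.mul_bdd (measurable_WTerm h hk n m).aestronglyMeasurable
      (ae_of_all _ fun p => abs_WTerm_le h hk m p)
  have := hasSum_integral_of_summable_integral_norm (F := fun m p => H p * WTerm φ k m p) hi ?_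
  · simpa only [integral_mul_WTerm h hk hH hHi, W_eq_tsum_WTerm, tsum_mul_left] using this
  · refine Summable.of_nonneg_of_le (fun m => integral_nonneg fun _ => norm_nonneg _) (fun m => ?_)
      ((hasSum_WBound φ ϑ n).summable.mul_left (∫ p, |H p| ∂(volume.prod volume)))
    rw [← integral_mul_const]
    refine integral_mono (hi m).norm (hHi.abs.mul_const _) fun p => ?_
    simp only [Real.norm_eq_abs, abs_mul]
    gcongr
    exact abs_WTerm_le h hk m p

end Mayer

/-! ### The weak form of the evolution equation -/

section PsiA

variable {d : ℕ} {α : ℝ}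

theorem psiA_nonneg (hα : 0 ≤ α) (x : Pt d) : 0 ≤ psiA α x := by
  unfold psiA; positivity

theorem psiA_le_one (hα : 0 ≤ α) (x : Pt d) : psiA α x ≤ 1 := by
  unfold psiA
  exact div_le_one_of_le₀ (by have : 0 ≤ α * ‖x‖ ^ (d + 1) := by positivity
                              linarith) (by positivity)

theorem abs_psiA_le_one (hα : 0 ≤ α) (x : Pt d) : |psiA α x| ≤ 1 := by
  rw [abs_of_nonneg (psiA_nonneg hα x)]; exact psiA_le_one hα x

theorem measurable_psiA (d : ℕ) (α : ℝ) : Measurable (psiA α : Pt d → ℝ) := by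
  unfold psiA; fun_prop

theorem psiA_zero (x : Pt d) : psiA 0 x = 1 := by simp [psiA]

theorem continuous_psi (d : ℕ) : Continuous (psi : Pt d → ℝ) := by
  unfold psi psiA
  refine continuous_const.div (by fun_prop) fun x => ?_
  positivity

theorem tendsto_psiA (x : Pt d) : Tendsto (fun α => psiA α x) (𝓝[>] 0) (𝓝 1) := by
  have : Tendsto (fun α => psiA α x) (𝓝 0) (𝓝 (psiA 0 x)) := by
    unfold psiA
    refine Tendsto.div tendsto_const_nhds (Continuous.tendsto (by fun_prop) 0) (by simp)
  rw [psiA_zero] at this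
  exact this.mono_left nhdsWithin_le_nhds

end PsiA

/-! ### The operator dual to `L^{Δ,α}`, acting on test functions. -/

section TestOp

variable {d n : ℕ} {a φ : Pt d → ℝ}

/-- The rate `a(x_i - y) ∏_{j ≠ i} e^{-φ(x_j - y)}`. -/
noncomputable def jumpWeight (a φ : Pt d → ℝ) (i : Fin n) (p : (Fin n → Pt d) × Pt d) : ℝ :=
  a (p.1 i - p.2) * ∏ j ∈ Finset.univ.erase i, Real.exp (-φ (p.1 j - p.2))

/-- The rate at which the `i`-th particle jumps, times the value of `g` after the jump. -/
noncomputable def gain (a φ : Pt d → ℝ) (g : (Fin n → Pt d) → ℝ) (i : Fin n)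
    (p : (Fin n → Pt d) × Pt d) : ℝ :=
  jumpWeight a φ i p * g (exchange i p).1

/-- The rate at which the `i`-th particle jumps, times the value of `g` before the jump. -/
noncomputable def loss (a φ : Pt d → ℝ) (g : (Fin n → Pt d) → ℝ) (i : Fin n)
    (p : (Fin n → Pt d) × Pt d) : ℝ :=
  jumpWeight a φ i p * g p.1

theorem ModelAssumptions.jumpWeight_nonneg (h : ModelAssumptions a φ) (i : Fin n)
    (p : (Fin n → Pt d) × Pt d) : 0 ≤ jumpWeight a φ i p :=
  mul_nonneg (h.nonneg_a _) (Finset.prod_nonneg fun _ _ => (Real.exp_pos _).le)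

theorem ModelAssumptions.jumpWeight_le (h : ModelAssumptions a φ) (i : Fin n)
    (p : (Fin n → Pt d) × Pt d) : jumpWeight a φ i p ≤ a (p.1 i - p.2) :=
  mul_le_of_le_one_right (h.nonneg_a _) (Finset.prod_le_one (fun _ _ => (Real.exp_pos _).le)
    fun _ _ => Real.exp_le_one_iff.2 (neg_nonpos.2 (h.nonneg_φ _)))

theorem ModelAssumptions.measurable_jumpWeight (h : ModelAssumptions a φ) (i : Fin n) :
    Measurable (jumpWeight a φ i) := by
  have h₁ := h.measurable_a
  have h₂ := h.measurable_φ
  unfold jumpWeight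
  refine Measurable.mul (by fun_prop) (Finset.measurable_fun_prod _ fun j _ => by fun_prop)

theorem integrable_mul_comp_sub {b : Pt d → ℝ} (hb : Integrable b)
    {g : (Fin n → Pt d) → ℝ} (hg : Integrable g) (hbm : Measurable b) (hgm : Measurable g)
    (i : Fin n) :
    Integrable (fun p : (Fin n → Pt d) × Pt d => b (p.1 i - p.2) * g p.1)
      (volume.prod volume) := by
  have hm : Measurable fun p : (Fin n → Pt d) × Pt d => b (p.1 i - p.2) * g p.1 := by fun_prop
  refine (integrable_prod_iff hm.aestronglyMeasurable).2 ⟨ae_of_all _ fun x =>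
    (hb.comp_sub_left (x i)).mul_const (g x), ?_⟩
  simp only [norm_mul, integral_mul_const]
  simp only [integral_sub_left_eq_self (fun y => ‖b y‖)]
  exact hg.norm.const_mul _

theorem integral_mul_comp_sub {b : Pt d → ℝ} (hb : Integrable b)
    {g : (Fin n → Pt d) → ℝ} (hg : Integrable g) (hbm : Measurable b) (hgm : Measurable g)
    (i : Fin n) :
    ∫ p : (Fin n → Pt d) × Pt d, b (p.1 i - p.2) * g p.1 ∂(volume.prod volume)
      = (∫ y, b y) * ∫ x, g x := by
  rw [integral_prod _ (integrable_mul_comp_sub hb hg hbm hgm i)]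
  simp only [integral_mul_const, integral_sub_left_eq_self (fun y => b y), integral_const_mul]

theorem ModelAssumptions.measurable_loss (h : ModelAssumptions a φ) {g : (Fin n → Pt d) → ℝ}
    (hgm : Measurable g) (i : Fin n) : Measurable (loss a φ g i) :=
  (h.measurable_jumpWeight i).mul (hgm.comp measurable_fst)

theorem ModelAssumptions.measurable_gain (h : ModelAssumptions a φ) {g : (Fin n → Pt d) → ℝ}
    (hgm : Measurable g) (i : Fin n) : Measurable (gain a φ g i) :=
  (h.measurable_jumpWeight i).mul
    (hgm.comp (measurable_fst.comp (measurePreserving_exchange (Pt d) i).measurable))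

theorem ModelAssumptions.integrable_loss (h : ModelAssumptions a φ) {g : (Fin n → Pt d) → ℝ}
    (hgm : Measurable g) (hg : Integrable g) (i : Fin n) :
    Integrable (loss a φ g i) (volume.prod volume) := by
  refine (integrable_mul_comp_sub h.integrable_a hg.abs h.measurable_a hgm.abs i).mono'
    (h.measurable_loss hgm i).aestronglyMeasurable (ae_of_all _ fun p => ?_)
  rw [loss, norm_mul, Real.norm_of_nonneg (h.jumpWeight_nonneg i p), Real.norm_eq_abs]
  gcongr
  exact h.jumpWeight_le i p

theorem ModelAssumptions.integral_abs_loss_le (h : ModelAssumptions a φ)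
    {g : (Fin n → Pt d) → ℝ} (hgm : Measurable g) (hg : Integrable g) (i : Fin n) :
    ∫ p, |loss a φ g i p| ∂(volume.prod volume) ≤ ∫ x, |g x| := by
  have := integral_mul_comp_sub h.integrable_a hg.abs h.measurable_a hgm.abs i
  rw [h.integral_a, one_mul] at this
  rw [← this]
  refine integral_mono (h.integrable_loss hgm hg i).abs
    (integrable_mul_comp_sub h.integrable_a hg.abs h.measurable_a hgm.abs i) fun p => ?_
  simp only [loss]
  rw [abs_mul, abs_of_nonneg (h.jumpWeight_nonneg i p)]
  gcongr
  exact h.jumpWeight_le i p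

/-- After the exchange, `g` is evaluated at the unexchanged points and the kernel is reflected.
Reflection does not affect its integral, so gain and loss have the same `L^1` bound. -/
theorem ModelAssumptions.abs_gain_le (h : ModelAssumptions a φ) (g : (Fin n → Pt d) → ℝ)
    (i : Fin n) (p : (Fin n → Pt d) × Pt d) : |gain a φ g i p| ≤
      (fun p : (Fin n → Pt d) × Pt d => a (-(p.1 i - p.2)) * |g p.1|) (exchange i p) := by
  simp only [gain]
  rw [abs_mul, abs_of_nonneg (h.jumpWeight_nonneg i p)]
  refine mul_le_mul_of_nonneg_right ((h.jumpWeight_le i p).trans_eq ?_) (abs_nonneg _)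
  simp [exchange]

theorem ModelAssumptions.integrable_gain (h : ModelAssumptions a φ) {g : (Fin n → Pt d) → ℝ}
    (hgm : Measurable g) (hg : Integrable g) (i : Fin n) :
    Integrable (gain a φ g i) (volume.prod volume) :=
  ((measurePreserving_exchange (Pt d) i).integrable_comp_of_integrable
    (integrable_mul_comp_sub h.integrable_a.comp_neg hg.abs
      (h.measurable_a.comp measurable_neg) hgm.abs i)).mono'
    (h.measurable_gain hgm i).aestronglyMeasurable (ae_of_all _ fun p => h.abs_gain_le g i p)

theorem ModelAssumptions.integral_abs_gain_le (h : ModelAssumptions a φ)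
    {g : (Fin n → Pt d) → ℝ} (hgm : Measurable g) (hg : Integrable g) (i : Fin n) :
    ∫ p, |gain a φ g i p| ∂(volume.prod volume) ≤ ∫ x, |g x| := by
  have hi := integrable_mul_comp_sub h.integrable_a.comp_neg hg.abs
    (h.measurable_a.comp measurable_neg) hgm.abs i
  have := integral_mul_comp_sub h.integrable_a.comp_neg hg.abs
    (h.measurable_a.comp measurable_neg) hgm.abs i
  rw [integral_neg_eq_self (fun y => a y), h.integral_a, one_mul] at this
  rw [← this, ← integral_comp_of_measurePreserving (measurePreserving_exchange (Pt d) i)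
    hi.aestronglyMeasurable]
  exact integral_mono (h.integrable_gain hgm hg i).abs
    ((measurePreserving_exchange (Pt d) i).integrable_comp_of_integrable hi)
    fun p => h.abs_gain_le g i p

/-- The component, from functions of `n` points to functions of `n + m` points, of the operator
dual to `L^{Δ,0}` which describes the jumps of the `i`-th particle. -/
noncomputable def testOp (a φ : Pt d → ℝ) (g : (Fin n → Pt d) → ℝ) (i : Fin n) (m : ℕ) :
    (Fin (n + m) → Pt d) → ℝ :=
  mayerLift φ (fun p => gain a φ g i p - loss a φ g i p) m

theorem ModelAssumptions.measurable_testOp (h : ModelAssumptions a φ) {g : (Fin n → Pt d) → ℝ}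
    (hgm : Measurable g) (i : Fin n) (m : ℕ) : Measurable (testOp a φ g i m) :=
  h.measurable_mayerLift ((h.measurable_gain hgm i).sub (h.measurable_loss hgm i)) m

theorem ModelAssumptions.integrable_testOp (h : ModelAssumptions a φ) {g : (Fin n → Pt d) → ℝ}
    (hgm : Measurable g) (hg : Integrable g) (i : Fin n) (m : ℕ) :
    Integrable (testOp a φ g i m) :=
  h.integrable_mayerLift ((h.measurable_gain hgm i).sub (h.measurable_loss hgm i))
    ((h.integrable_gain hgm hg i).sub (h.integrable_loss hgm hg i)) m

theorem ModelAssumptions.integral_abs_testOp_le (h : ModelAssumptions a φ)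
    {g : (Fin n → Pt d) → ℝ} (hgm : Measurable g) (hg : Integrable g) (i : Fin n) (m : ℕ) :
    ∫ v, |testOp a φ g i m v| ≤ 2 * mayerNorm φ ^ m * ∫ x, |g x| := by
  have hG := h.integrable_gain hgm hg i
  have hL := h.integrable_loss hgm hg i
  refine (h.integral_abs_mayerLift_le ((h.measurable_gain hgm i).sub (h.measurable_loss hgm i))
    (hG.sub hL) m).trans ?_
  have : ∫ p, |gain a φ g i p - loss a φ g i p| ∂(volume.prod volume) ≤ 2 * ∫ x, |g x| := by
    calc ∫ p, |gain a φ g i p - loss a φ g i p| ∂(volume.prod volume)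
        ≤ ∫ p, (|gain a φ g i p| + |loss a φ g i p|) ∂(volume.prod volume) :=
          integral_mono (hG.sub hL).abs (hG.abs.add hL.abs) fun p => abs_sub _ _
      _ = (∫ p, |gain a φ g i p| ∂(volume.prod volume))
            + ∫ p, |loss a φ g i p| ∂(volume.prod volume) := integral_add hG.abs hL.abs
      _ ≤ _ := by linarith [h.integral_abs_gain_le hgm hg i, h.integral_abs_loss_le hgm hg i]
  calc _ ≤ mayerNorm φ ^ m * (2 * ∫ x, |g x|) :=
        mul_le_mul_of_nonneg_left this (pow_nonneg (mayerNorm_nonneg φ) m)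
    _ = _ := by ring

/-- The factor `ψ_α` sits at the departure point `x_i`, not at the integration variable `y`. This is
what leaves the dual operator independent of `α` apart from a multiplier. -/
theorem mayerLift_psiA_mul (α : ℝ) (H : (Fin n → Pt d) × Pt d → ℝ) (i : Fin n) (m : ℕ)
    (v : Fin (n + m) → Pt d) :
    mayerLift φ (fun p => psiA α (p.1 i) * H p) m v
      = psiA α (v (Fin.castAdd m i)) * mayerLift φ H m v := by
  simp only [mayerLift, mul_assoc, integral_const_mul]

theorem integrable_psiA_mul {α : ℝ} (hα : 0 ≤ α) (i : Fin n) {H : (Fin n → Pt d) × Pt d → ℝ}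
    (hH : Integrable H (volume.prod volume)) :
    Integrable (fun p => psiA α (p.1 i) * H p) (volume.prod volume) :=
  hH.bdd_mul (c := 1) ((measurable_psiA d α).comp
    ((measurable_pi_apply i).comp measurable_fst)).aestronglyMeasurable
    (ae_of_all _ fun _ => abs_psiA_le_one hα _)

variable {ϑ α : ℝ} {k : FinFun d}

/-- In the gain term the particle found at `x_i` has come from `z`. The exchange puts `z` in
coordinate `i` and `x_i` in the role of the arrival point, so that `ψ_α(z)` becomes `ψ_α` of
coordinate `i`, exactly as in the loss term. -/
theorem gain_term_mul (g : (Fin n → Pt d) → ℝ) (i : Fin n) (x : Fin n → Pt d) :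
    (∫ z, jumpRate a α z (x i) * (∏ j ∈ Finset.univ.erase i, Real.exp (-φ (x j - x i))) *
      W φ k (x i) n (Function.update x i z)) * g x
    = ∫ z, (fun p => psiA α (p.1 i) * gain a φ g i p * W φ k p.2 n p.1) (exchange i (x, z)) := by
  rw [← integral_mul_const]
  refine integral_congr_ae (ae_of_all _ fun z => ?_)
  have hx : ∀ j ∈ Finset.univ.erase i, Real.exp (-φ (Function.update x i z j - x i))
      = Real.exp (-φ (x j - x i)) := fun j hj => by
    rw [Function.update_of_ne (Finset.ne_of_mem_erase hj)]
  simp only [gain, jumpWeight, exchange_exchange]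
  simp only [exchange, Function.update_self, Finset.prod_congr rfl hx, jumpRate]
  ring

theorem loss_term_mul (g : (Fin n → Pt d) → ℝ) (i : Fin n) (x : Fin n → Pt d) :
    (∫ y, jumpRate a α (x i) y * (∏ j ∈ Finset.univ.erase i, Real.exp (-φ (x j - y))) *
      W φ k y n x) * g x
    = ∫ y, (fun p => psiA α (p.1 i) * loss a φ g i p * W φ k p.2 n p.1) (x, y) := by
  rw [← integral_mul_const]
  refine integral_congr_ae (ae_of_all _ fun z => ?_)
  simp only [loss, jumpWeight, jumpRate]
  ring

theorem LDelta_mul (g : (Fin n → Pt d) → ℝ) (x : Fin n → Pt d) :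
    LDelta a φ α k n x * g x
      = (∑ i, ∫ z, (fun p => psiA α (p.1 i) * gain a φ g i p * W φ k p.2 n p.1)
          (exchange i (x, z)))
        - ∑ i, ∫ y, (fun p => psiA α (p.1 i) * loss a φ g i p * W φ k p.2 n p.1) (x, y) := by
  rw [LDelta, sub_mul, Finset.sum_mul, Finset.sum_mul]
  simp only [← gain_term_mul, ← loss_term_mul]

theorem integrable_LDelta_mul (h : ModelAssumptions a φ) (hk : IsBoundedFun ϑ k) (hα : 0 ≤ α)
    {g : (Fin n → Pt d) → ℝ} (hgm : Measurable g) (hg : Integrable g) :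
    Integrable fun x => LDelta a φ α k n x * g x := by
  simp only [LDelta_mul]
  refine Integrable.sub (integrable_finsetSum _ fun i _ => ?_)
    (integrable_finsetSum _ fun i _ => ?_)
  · exact ((measurePreserving_exchange (Pt d) i).integrable_comp_of_integrable
      (integrable_mul_W h hk (integrable_psiA_mul hα i
        (h.integrable_gain hgm hg i)))).integral_prod_left
  · exact (integrable_mul_W h hk (integrable_psiA_mul hα i
      (h.integrable_loss hgm hg i))).integral_prod_left

/-- Since the exchange preserves the product measure, it can be undone in the gain term after
integrating over all points; gain and loss then combine under one integral. -/
theorem integral_LDelta_mul_eq_sum (h : ModelAssumptions a φ) (hk : IsBoundedFun ϑ k)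
    (hα : 0 ≤ α) {g : (Fin n → Pt d) → ℝ} (hgm : Measurable g) (hg : Integrable g) :
    ∫ x, LDelta a φ α k n x * g x
      = ∑ i : Fin n, ∫ p : (Fin n → Pt d) × Pt d, psiA α (p.1 i) * (gain a φ g i p - loss a φ g i p) * W φ k p.2 n p.1
          ∂(volume.prod volume) := by
  have hG : ∀ i, Integrable (fun p => psiA α (p.1 i) * gain a φ g i p * W φ k p.2 n p.1)
      (volume.prod volume) := fun i =>
    integrable_mul_W h hk (integrable_psiA_mul hα i (h.integrable_gain hgm hg i))
  have hL : ∀ i, Integrable (fun p => psiA α (p.1 i) * loss a φ g i p * W φ k p.2 n p.1)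
      (volume.prod volume) := fun i =>
    integrable_mul_W h hk (integrable_psiA_mul hα i (h.integrable_loss hgm hg i))
  have hG' := fun i =>
    (measurePreserving_exchange (Pt d) i).integrable_comp_of_integrable (hG i)
  have h₁ : ∀ i, Integrable fun x => ∫ z, (fun p => psiA α (p.1 i) * gain a φ g i p *
      W φ k p.2 n p.1) (exchange i (x, z)) := fun i => (hG' i).integral_prod_left
  have h₂ : ∀ i, Integrable fun x => ∫ y, (fun p => psiA α (p.1 i) * loss a φ g i p *
      W φ k p.2 n p.1) (x, y) := fun i => (hL i).integral_prod_left
  simp only [LDelta_mul]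
  rw [integral_sub (integrable_finsetSum _ fun i _ => h₁ i)
    (integrable_finsetSum _ fun i _ => h₂ i), integral_finsetSum _ fun i _ => h₁ i,
    integral_finsetSum _ fun i _ => h₂ i, ← Finset.sum_sub_distrib]
  refine Finset.sum_congr rfl fun i _ => ?_
  have e₁ := (integral_prod _ (hG' i)).symm.trans (integral_comp_of_measurePreserving
    (measurePreserving_exchange (Pt d) i) (hG i).aestronglyMeasurable)
  have e₂ := (integral_prod _ (hL i)).symm
  simp only [Function.comp_apply] at e₁
  rw [e₁, e₂, ← integral_sub (hG i) (hL i)]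
  refine integral_congr_ae (ae_of_all _ fun p => ?_)
  ring

/-- The weak form of the operator `L^{Δ,α}`. -/
theorem integral_LDelta_mul (h : ModelAssumptions a φ) (hk : IsBoundedFun ϑ k)
    (hα : 0 ≤ α) {g : (Fin n → Pt d) → ℝ} (hgm : Measurable g) (hg : Integrable g) :
    ∫ x, LDelta a φ α k n x * g x = ∑ i : Fin n, ∑' m : ℕ, (1 / (m.factorial : ℝ)) *
      ∫ v, k (n + m) v * (psiA α (v (Fin.castAdd m i)) * testOp a φ g i m v) := by
  rw [integral_LDelta_mul_eq_sum h hk hα hgm hg]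
  refine Finset.sum_congr rfl fun i _ => ?_
  have hm : Measurable fun p : (Fin n → Pt d) × Pt d =>
      psiA α (p.1 i) * (gain a φ g i p - loss a φ g i p) :=
    ((measurable_psiA d α).comp ((measurable_pi_apply i).comp measurable_fst)).mul
      ((h.measurable_gain hgm i).sub (h.measurable_loss hgm i))
  rw [← (hasSum_integral_mul_W h hk hm (integrable_psiA_mul hα i
    ((h.integrable_gain hgm hg i).sub (h.integrable_loss hgm hg i)))).tsum_eq]
  simp only [mayerLift_psiA_mul, testOp]

end TestOp

/-! ### Estimates along the evolution -/

/-- Both `B - f` and `B + f` have nonnegative derivative inside the interval, hence are monotone. No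
integrability of `f'` is needed. -/
theorem abs_sub_le_of_hasDerivAt_le {f f' B B' : ℝ → ℝ} {δ : ℝ} (hf : ContinuousOn f (Icc 0 δ))
    (hf' : ∀ τ ∈ Ioo 0 δ, HasDerivAt f (f' τ) τ) (hB : ∀ τ, HasDerivAt B (B' τ) τ)
    (hle : ∀ τ ∈ Ioo 0 δ, |f' τ| ≤ B' τ) {τ : ℝ} (hτ : τ ∈ Icc 0 δ) :
    |f τ - f 0| ≤ B τ - B 0 := by
  have hBc : Continuous B := continuous_iff_continuousAt.2 fun τ => (hB τ).continuousAt
  have h₁ : MonotoneOn (fun τ => B τ - f τ) (Icc 0 δ) := by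
    refine monotoneOn_of_deriv_nonneg (convex_Icc 0 δ) (hBc.continuousOn.sub hf) ?_ ?_ <;>
      rw [interior_Icc] <;> intro τ hτ
    · exact ((hB τ).sub (hf' τ hτ)).differentiableAt.differentiableWithinAt
    · rw [((hB τ).fun_sub (hf' τ hτ)).deriv]
      linarith [(abs_le.1 (hle τ hτ)).2]
  have h₂ : MonotoneOn (fun τ => B τ + f τ) (Icc 0 δ) := by
    refine monotoneOn_of_deriv_nonneg (convex_Icc 0 δ) (hBc.continuousOn.add hf) ?_ ?_ <;>
      rw [interior_Icc] <;> intro τ hτ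
    · exact ((hB τ).add (hf' τ hτ)).differentiableAt.differentiableWithinAt
    · rw [((hB τ).fun_add (hf' τ hτ)).deriv]
      linarith [(abs_le.1 (hle τ hτ)).1]
  have h0 : (0 : ℝ) ∈ Icc 0 δ := ⟨le_rfl, hτ.1.trans hτ.2⟩
  have i₁ := h₁ h0 hτ hτ.1
  have i₂ := h₂ h0 hτ hτ.1
  simp only at i₁ i₂
  rw [abs_le]
  constructor <;> linarith

/-- The tail of the series is small uniformly in the parameters thanks to the common majorant `C`;
only finitely many terms remain, and these can be controlled simultaneously. -/
theorem eventually_abs_tsum_le {A : Type*} {l : Filter A} {S : Set ℝ} {u : A → ℝ → ℕ → ℝ}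
    {β : ℝ → ℕ → ℝ} {C : ℕ → ℝ} {b : ℝ → ℝ} (hC : Summable C)
    (huC : ∀ᶠ α in l, ∀ τ ∈ S, ∀ m, |u α τ m| ≤ C m) (hβ : ∀ τ m, 0 ≤ β τ m)
    (hb : ∀ τ, HasSum (β τ) (b τ))
    (hu : ∀ m, ∀ ε > 0, ∀ᶠ α in l, ∀ τ ∈ S, |u α τ m| ≤ β τ m + ε) {ε : ℝ} (hε : 0 < ε) :
    ∀ᶠ α in l, ∀ τ ∈ S, |∑' m, u α τ m| ≤ b τ + ε := by
  obtain ⟨M, hM⟩ : ∃ M : ℕ, ∑' m, C (m + M) < ε / 2 :=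
    ((tendsto_sum_nat_add C).eventually (gt_mem_nhds (half_pos hε))).exists
  -- The error `ε/2` is shared among `M` terms; the denominator `M + 1` allows `M = 0`.
  have hM' : 0 < ε / 2 / (M + 1) := by positivity
  have hfin : ∀ᶠ α in l, ∀ m ∈ Finset.range M, ∀ τ ∈ S,
      |u α τ m| ≤ β τ m + ε / 2 / (M + 1) := by
    rw [eventually_all_finset]
    exact fun m _ => hu m _ hM'
  filter_upwards [huC, hfin] with α h₁ h₂ τ hτ
  have hs : Summable fun m => |u α τ m| :=
    Summable.of_nonneg_of_le (fun _ => abs_nonneg _) (h₁ τ hτ) hC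
  have hs' : Summable fun m => C (m + M) := (summable_nat_add_iff M).2 hC
  calc |∑' m, u α τ m| ≤ ∑' m, |u α τ m| := by
        simpa only [Real.norm_eq_abs] using norm_tsum_le_tsum_norm (f := u α τ) hs
    _ = ∑ m ∈ Finset.range M, |u α τ m| + ∑' m, |u α τ (m + M)| := (hs.sum_add_tsum_nat_add M).symm
    _ ≤ ∑ m ∈ Finset.range M, (β τ m + ε / 2 / (M + 1)) + ∑' m, C (m + M) := by
        gcongr with m hm m
        · exact h₂ m hm τ hτ
        · exact (summable_nat_add_iff (f := fun m => |u α τ m|) M).2 hs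
        · exact h₁ τ hτ _
    _ ≤ b τ + ε / 2 + ε / 2 := by
        rw [Finset.sum_add_distrib, Finset.sum_const, Finset.card_range, nsmul_eq_mul]
        have e₁ : ∑ m ∈ Finset.range M, β τ m ≤ b τ := sum_le_hasSum _ (fun m _ => hβ τ m) (hb τ)
        have e₂ : (M : ℝ) * (ε / 2 / (M + 1)) ≤ ε / 2 := by
          rw [mul_div_assoc', div_le_iff₀ (by positivity)]
          nlinarith
        linarith
    _ = _ := by ring

/-! ### Pairings with a fixed integrable function as functions of time. -/

section Norms

variable {d : ℕ}

theorem abs_integral_mul_le_kNorm {ϑ : ℝ} {F : FinFun d} (hF : kNorm ϑ F ≠ ∞) {n : ℕ}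
    {g : (Fin n → Pt d) → ℝ} (hg : Integrable g) :
    |∫ x, F n x * g x| ≤ Real.exp (ϑ * n) * (kNorm ϑ F).toReal * ∫ x, |g x| := by
  have h₁ : ENNReal.ofReal (Real.exp (-ϑ * n)) * eLpNorm (F n) ∞ volume ≤ kNorm ϑ F :=
    le_iSup (fun n : ℕ => ENNReal.ofReal (Real.exp (-ϑ * n)) * eLpNorm (F n) ∞ volume) n
  have h₂ : eLpNorm (F n) ∞ volume ≤
      ENNReal.ofReal (Real.exp (ϑ * n) * (kNorm ϑ F).toReal) := by
    calc eLpNorm (F n) ∞ volume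
        = ENNReal.ofReal (Real.exp (ϑ * n)) *
          (ENNReal.ofReal (Real.exp (-ϑ * n)) * eLpNorm (F n) ∞ volume) := by
          rw [← mul_assoc, ← ENNReal.ofReal_mul (Real.exp_pos _).le, ← Real.exp_add]
          simp
      _ ≤ ENNReal.ofReal (Real.exp (ϑ * n)) * kNorm ϑ F := by gcongr
      _ = _ := by rw [ENNReal.ofReal_mul (Real.exp_pos _).le, ENNReal.ofReal_toReal hF]
  have h₃ : ∀ᵐ x, |F n x| ≤ Real.exp (ϑ * n) * (kNorm ϑ F).toReal := by
    rw [eLpNorm_exponent_top] at h₂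
    filter_upwards [enorm_ae_le_eLpNormEssSup (F n) volume] with x hx
    have := hx.trans h₂
    rwa [Real.enorm_eq_ofReal_abs, ENNReal.ofReal_le_ofReal_iff (by positivity)] at this
  rw [← integral_const_mul, ← Real.norm_eq_abs]
  refine norm_integral_le_of_norm_le (hg.abs.const_mul _) ?_
  filter_upwards [h₃] with x hx
  rw [norm_mul, Real.norm_eq_abs, Real.norm_eq_abs]
  gcongr

theorem tendsto_integral_mul_of_kNorm {A : Type*} {l : Filter A} {ϑ : ℝ} {F : A → FinFun d}
    (hF : Tendsto (fun s => kNorm ϑ (F s)) l (𝓝 0)) {n : ℕ} {g : (Fin n → Pt d) → ℝ}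
    (hg : Integrable g) : Tendsto (fun s => ∫ x, F s n x * g x) l (𝓝 0) := by
  have h₁ : Tendsto (fun s => Real.exp (ϑ * n) * (kNorm ϑ (F s)).toReal * ∫ x, |g x|) l (𝓝 0) := by
    have := (ENNReal.tendsto_toReal ENNReal.zero_ne_top).comp hF
    simpa using (this.const_mul (Real.exp (ϑ * n))).mul_const (∫ x, |g x|)
  refine squeeze_zero_norm' ?_ h₁
  filter_upwards [hF.eventually_lt_const (u := ∞) (by simp)] with s hs
  exact abs_integral_mul_le_kNorm hs.ne hg

theorem IsBoundedFun.integrable_mul {ϑ : ℝ} {k : FinFun d} (hk : IsBoundedFun ϑ k) {n : ℕ}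
    {g : (Fin n → Pt d) → ℝ} (hg : Integrable g) : Integrable fun x => k n x * g x :=
  hg.bdd_mul (hk.measurable n).aestronglyMeasurable (ae_of_all _ fun x => hk.abs_le n x)

theorem IsBoundedFun.abs_integral_mul_le {ϑ : ℝ} {k : FinFun d} (hk : IsBoundedFun ϑ k) {n : ℕ}
    {g : (Fin n → Pt d) → ℝ} (hg : Integrable g) :
    |∫ x, k n x * g x| ≤ Real.exp (ϑ * n) * ∫ x, |g x| := by
  rw [← integral_const_mul, ← Real.norm_eq_abs]
  refine norm_integral_le_of_norm_le (hg.abs.const_mul _) (ae_of_all _ fun x => ?_)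
  rw [norm_mul, Real.norm_eq_abs, Real.norm_eq_abs]
  gcongr
  exact hk.abs_le n x

variable {a φ : Pt d → ℝ} {α ϑ₀ : ℝ} {μ₀ : ProbabilityMeasure (TemperedConfig d)}
  {μ : ℝ → ProbabilityMeasure (TemperedConfig d)} {k : ℝ → FinFun d}

theorem IsStateEvolution.isBoundedFun (hk : IsStateEvolution a φ α ϑ₀ μ₀ μ k) {t T : ℝ}
    (ht : 0 ≤ t) (htT : t ≤ T) : IsBoundedFun (ϑ₀ + T) (k t) := by
  refine ⟨(hk.correlation t ht).measurable, fun n x => ?_⟩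
  rw [abs_of_nonneg ((hk.correlation t ht).nonneg n x)]
  refine (hk.bound t ht n x).trans (Real.exp_le_exp.2 ?_)
  gcongr

theorem IsStateEvolution.continuousOn_integral (hk : IsStateEvolution a φ α ϑ₀ μ₀ μ k) {n : ℕ}
    {g : (Fin n → Pt d) → ℝ} (hg : Integrable g) :
    ContinuousOn (fun t => ∫ x, k t n x * g x) (Ici 0) := by
  intro t ht
  -- Any horizon beyond `t` would do; `t + 1` is one.
  have h₁ := tendsto_integral_mul_of_kNorm (hk.continuous (t + 1) t ht (by linarith)) (n := n) hg
  have h₂ := h₁.add_const (∫ x, k t n x * g x)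
  rw [zero_add] at h₂
  refine h₂.congr' ?_
  filter_upwards [self_mem_nhdsWithin] with s hs
  rw [← eq_sub_iff_add_eq, ← integral_sub ((hk.isBoundedFun hs le_rfl).integrable_mul hg)
      ((hk.isBoundedFun ht le_rfl).integrable_mul hg)]
  simp only [Pi.sub_apply, sub_mul]

theorem IsStateEvolution.hasDerivAt_integral (h : ModelAssumptions a φ) (hα : 0 ≤ α)
    (hk : IsStateEvolution a φ α ϑ₀ μ₀ μ k) {n : ℕ} {g : (Fin n → Pt d) → ℝ} (hgm : Measurable g)
    (hg : Integrable g) {t : ℝ} (ht : 0 < t) :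
    HasDerivAt (fun t => ∫ x, k t n x * g x) (∫ x, LDelta a φ α (k t) n x * g x) t := by
  rw [hasDerivAt_iff_tendsto_slope_zero]
  have h₁ := tendsto_integral_mul_of_kNorm (hk.deriv (t + 1) t ht (by linarith)) (n := n) hg
  have h₂ := h₁.add_const (∫ x, LDelta a φ α (k t) n x * g x)
  rw [zero_add] at h₂
  refine h₂.congr' ?_
  -- The bounds on `k` hold at nonnegative times only, so increments leading below time 0 are
  -- excluded.
  have hpos : ∀ᶠ s in 𝓝[≠] (0 : ℝ), 0 < t + s := by
    refine nhdsWithin_le_nhds ?_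
    have : Tendsto (fun s => t + s) (𝓝 0) (𝓝 (t + 0)) := (continuous_const.add continuous_id).tendsto 0
    exact this.eventually (lt_mem_nhds (by simpa using ht))
  filter_upwards [hpos] with s hs
  have i₁ := (hk.isBoundedFun hs.le le_rfl).integrable_mul (n := n) hg
  have i₂ := (hk.isBoundedFun ht.le le_rfl).integrable_mul (n := n) hg
  have i₁₂ : Integrable fun x => s⁻¹ * (k (t + s) n x * g x - k t n x * g x) :=
    (i₁.sub i₂).const_mul _
  have i₃ := integrable_LDelta_mul h (hk.isBoundedFun ht.le le_rfl) hα (n := n) hgm hg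
  rw [← integral_sub i₁ i₂, smul_eq_mul, ← integral_const_mul, ← eq_sub_iff_add_eq,
    ← integral_sub i₁₂ i₃]
  refine integral_congr_ae (ae_of_all _ fun x => ?_)
  simp only [Pi.sub_apply, Pi.smul_apply, smul_eq_mul]
  ring

end Norms

/-! ### Convergence of the correlation functions -/

section Convergence

variable {d : ℕ} {a φ : Pt d → ℝ}

theorem integrable_psiA_mul_comp {α : ℝ} (hα : 0 ≤ α) {n : ℕ} (i : Fin n)
    {B : (Fin n → Pt d) → ℝ} (hB : Integrable B) : Integrable fun v => psiA α (v i) * B v :=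
  hB.bdd_mul (c := 1) ((measurable_psiA d α).comp (measurable_pi_apply i)).aestronglyMeasurable
    (ae_of_all _ fun _ => abs_psiA_le_one hα _)

theorem abs_psiA_sub_one_le {α : ℝ} (hα : 0 ≤ α) (x : Pt d) : |psiA α x - 1| ≤ 1 := by
  rw [abs_le]
  constructor <;> linarith [psiA_nonneg hα x, psiA_le_one hα x]

theorem tendsto_integral_psiA_sub_one_mul {n : ℕ} (i : Fin n) {B : (Fin n → Pt d) → ℝ}
    (hB : Integrable B) :
    Tendsto (fun α => ∫ v, |(psiA α (v i) - 1) * B v|) (𝓝[>] 0) (𝓝 0) := by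
  have : Tendsto (fun α => ∫ v, |(psiA α (v i) - 1) * B v|) (𝓝[>] 0)
      (𝓝 (∫ _ : Fin n → Pt d, (0 : ℝ))) := by
    refine tendsto_integral_filter_of_dominated_convergence (fun v => |B v|)
      (Eventually.of_forall fun α => ?_) ?_ hB.abs (ae_of_all _ fun v => ?_)
    · exact (((((measurable_psiA d α).comp (measurable_pi_apply i)).sub_const
        1).aestronglyMeasurable).mul hB.aestronglyMeasurable).norm
    · filter_upwards [self_mem_nhdsWithin] with α hα
      refine ae_of_all _ fun v => ?_
      rw [Real.norm_eq_abs, abs_abs, abs_mul]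
      exact mul_le_of_le_one_left (abs_nonneg _) (abs_psiA_sub_one_le (le_of_lt hα) _)
    · have := (((tendsto_psiA (v i)).sub_const 1).mul_const (B v)).abs
      simpa using this
  simpa using this

/-- A majorant summable in `m` and independent of `α`; it also depends on `k` only through `ϑ`,
hence serves for all times up to the horizon. The factor 2 counts gain and loss. -/
theorem IsBoundedFun.abs_weak_term_le (h : ModelAssumptions a φ) {ϑ : ℝ} {k : FinFun d}
    (hk : IsBoundedFun ϑ k) {α : ℝ} (hα : 0 ≤ α) {n : ℕ} {g : (Fin n → Pt d) → ℝ}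
    (hgm : Measurable g) (hg : Integrable g) (i : Fin n) (m : ℕ) :
    |(1 / (m.factorial : ℝ)) *
      ∫ v, k (n + m) v * (psiA α (v (Fin.castAdd m i)) * testOp a φ g i m v)|
      ≤ WBound φ ϑ n m * (2 * ∫ x, |g x|) := by
  have hB := h.integrable_testOp hgm hg i m
  have hψB := integrable_psiA_mul_comp hα (Fin.castAdd m i) hB
  rw [abs_mul, abs_of_nonneg (by positivity), WBound_eq]
  calc _ ≤ (1 / (m.factorial : ℝ)) * (Real.exp (ϑ * (n + m : ℕ)) *
        ∫ v, |psiA α (v (Fin.castAdd m i)) * testOp a φ g i m v|) := by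
        gcongr
        exact hk.abs_integral_mul_le hψB
    _ ≤ (1 / (m.factorial : ℝ)) * (Real.exp (ϑ * (n + m : ℕ)) *
        (2 * mayerNorm φ ^ m * ∫ x, |g x|)) := by
        gcongr
        refine le_trans (integral_mono hψB.abs hB.abs fun v => ?_)
          (h.integral_abs_testOp_le hgm hg i m)
        simp only [abs_mul]
        exact mul_le_of_le_one_left (abs_nonneg _) (abs_psiA_le_one hα _)
    _ = _ := by ring

theorem integral_LDelta_sub (h : ModelAssumptions a φ) {ϑ : ℝ} {k k' : FinFun d}
    (hk : IsBoundedFun ϑ k) (hk' : IsBoundedFun ϑ k') {α : ℝ} (hα : 0 ≤ α) {n : ℕ}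
    {g : (Fin n → Pt d) → ℝ} (hgm : Measurable g) (hg : Integrable g) :
    (∫ x, LDelta a φ α k n x * g x) - ∫ x, LDelta a φ 0 k' n x * g x
      = ∑ i : Fin n, ∑' m : ℕ, (1 / (m.factorial : ℝ)) *
        ((∫ v, k (n + m) v * (psiA α (v (Fin.castAdd m i)) * testOp a φ g i m v))
          - ∫ v, k' (n + m) v * testOp a φ g i m v) := by
  have hs := (hasSum_WBound φ ϑ n).summable.mul_right (2 * ∫ x, |g x|)
  rw [integral_LDelta_mul h hk hα hgm hg, integral_LDelta_mul h hk' le_rfl hgm hg,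
    ← Finset.sum_sub_distrib]
  refine Finset.sum_congr rfl fun i _ => ?_
  rw [← (hs.of_norm_bounded fun m => hk.abs_weak_term_le h hα hgm hg i m).tsum_sub
    (hs.of_norm_bounded fun m => hk'.abs_weak_term_le h le_rfl hgm hg i m)]
  simp only [psiA_zero, one_mul, mul_sub]

variable {ϑ₀ : ℝ} {μ₀ : ProbabilityMeasure (TemperedConfig d)}
  {μ : ℝ → ℝ → ProbabilityMeasure (TemperedConfig d)} {k : ℝ → ℝ → FinFun d}

/-- The difference between the integrals of `g` against the correlation functions of two
evolutions. -/
noncomputable def corrDiff (k : ℝ → ℝ → FinFun d) (α t : ℝ) (n : ℕ) (g : (Fin n → Pt d) → ℝ) : ℝ :=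
  (∫ x, k α t n x * g x) - ∫ x, k 0 t n x * g x

theorem abs_corrDiff_le (hμ : ∀ α ∈ Icc (0 : ℝ) 1, IsStateEvolution a φ α ϑ₀ μ₀ (μ α) (k α))
    {α t T : ℝ} (hα : α ∈ Icc (0 : ℝ) 1) (ht : 0 ≤ t) (htT : t ≤ T) {n : ℕ}
    {g : (Fin n → Pt d) → ℝ} (hg : Integrable g) :
    |corrDiff k α t n g| ≤ 2 * (Real.exp ((ϑ₀ + T) * n) * ∫ x, |g x|) := by
  have h₁ := ((hμ α hα).isBoundedFun ht htT).abs_integral_mul_le hg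
  have h₂ := ((hμ 0 (by simp)).isBoundedFun ht htT).abs_integral_mul_le hg
  exact (abs_sub _ _).trans (by linarith)

/-- The correlation functions at time `t` converge weakly as `α → 0+`. -/
def WeaklyConverges (k : ℝ → ℝ → FinFun d) (t : ℝ) : Prop :=
  ∀ (n : ℕ) (g : (Fin n → Pt d) → ℝ), Measurable g → Integrable g →
    Tendsto (fun α => corrDiff k α t n g) (𝓝[>] 0) (𝓝 0)

/-- An approximate estimate of the differences of the correlation functions on `[s, s + δ]`, with a
weight which grows in time at the rate `lam` and with a factor `c`. -/
def ApproxBound (k : ℝ → ℝ → FinFun d) (s δ ϑ lam c : ℝ) : Prop :=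
  ∀ (n : ℕ) (g : (Fin n → Pt d) → ℝ), Measurable g → Integrable g → ∀ ε > 0,
    ∀ᶠ α in 𝓝[>] 0, ∀ τ ∈ Icc 0 δ,
      |corrDiff k α (s + τ) n g| ≤ c * Real.exp ((ϑ + lam * τ) * n) * (∫ x, |g x|) + ε

theorem eventually_mem_Icc : ∀ᶠ α : ℝ in 𝓝[>] 0, α ∈ Icc (0 : ℝ) 1 := by
  filter_upwards [Ioc_mem_nhdsGT (zero_lt_one' ℝ)] with α hα using ⟨hα.1.le, hα.2⟩

/-- The start of the iteration: each of the two evolutions obeys the a priori bound, and this gives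
the factor 2. -/
theorem approxBound_two (hμ : ∀ α ∈ Icc (0 : ℝ) 1, IsStateEvolution a φ α ϑ₀ μ₀ (μ α) (k α))
    {s δ T lam : ℝ} (hs : 0 ≤ s) (hsT : s + δ ≤ T) (hlam : 0 ≤ lam) :
    ApproxBound k s δ (ϑ₀ + T) lam 2 := by
  intro n g _ hg ε hε
  filter_upwards [eventually_mem_Icc] with α hα τ hτ
  have h₁ := abs_corrDiff_le hμ hα (add_nonneg hs hτ.1)
    (show s + τ ≤ T by linarith [hτ.2]) hg
  have h₂ : Real.exp ((ϑ₀ + T) * n) ≤ Real.exp ((ϑ₀ + T + lam * τ) * n) := by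
    have := mul_nonneg hlam hτ.1
    exact Real.exp_le_exp.2 (mul_le_mul_of_nonneg_right (by linarith) (Nat.cast_nonneg n))
  have h₃ : 0 ≤ ∫ x, |g x| := integral_nonneg fun _ => abs_nonneg _
  nlinarith [mul_le_mul_of_nonneg_right h₂ h₃]

/-- The assumed estimate applies to `testOp a φ g i m`, itself an integrable test function of `n +
m` points. Replacing `ψ_α` by 1 costs an error that vanishes by dominated convergence, uniformly in
time because `k` is bounded on the whole interval. The main terms sum to an exponential series. -/
theorem eventually_abs_tsum_weak_term_le (h : ModelAssumptions a φ)
    (hμ : ∀ α ∈ Icc (0 : ℝ) 1, IsStateEvolution a φ α ϑ₀ μ₀ (μ α) (k α))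
    {s δ T lam c : ℝ} (hs : 0 ≤ s) (hsT : s + δ ≤ T) (hc : 0 ≤ c)
    (hb : ApproxBound k s δ (ϑ₀ + T) lam c) {n : ℕ} {g : (Fin n → Pt d) → ℝ} (hgm : Measurable g)
    (hg : Integrable g) (i : Fin n) {ε : ℝ} (hε : 0 < ε) :
    ∀ᶠ α in 𝓝[>] 0, ∀ τ ∈ Icc 0 δ, |∑' m : ℕ, (1 / (m.factorial : ℝ)) *
        ((∫ v, k α (s + τ) (n + m) v * (psiA α (v (Fin.castAdd m i)) * testOp a φ g i m v))
          - ∫ v, k 0 (s + τ) (n + m) v * testOp a φ g i m v)|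
      ≤ Real.exp ((ϑ₀ + T + lam * τ) * n) *
          Real.exp (Real.exp (ϑ₀ + T + lam * τ) * mayerNorm φ) * (c * (2 * ∫ x, |g x|)) + ε := by
  have hs₁ := (hasSum_WBound φ (ϑ₀ + T) n).summable.mul_right (2 * ∫ x, |g x|)
  have hG : 0 ≤ ∫ x, |g x| := integral_nonneg fun _ => abs_nonneg _
  have hW0 : ∀ ϑ m, 0 ≤ WBound φ ϑ n m := fun ϑ m => by
    have := mayerNorm_nonneg φ
    unfold WBound; positivity
  refine eventually_abs_tsum_le
    (u := fun α τ (m : ℕ) => (1 / (m.factorial : ℝ)) *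
        ((∫ v, k α (s + τ) (n + m) v * (psiA α (v (Fin.castAdd m i)) * testOp a φ g i m v))
          - ∫ v, k 0 (s + τ) (n + m) v * testOp a φ g i m v))
    (β := fun τ m => WBound φ (ϑ₀ + T + lam * τ) n m * (c * (2 * ∫ x, |g x|)))
    (hs₁.add hs₁) ?_ (fun τ m => mul_nonneg (hW0 _ _) (by positivity))
    (fun τ => (hasSum_WBound φ (ϑ₀ + T + lam * τ) n).mul_right _) ?_ hε
  · filter_upwards [eventually_mem_Icc] with α hα τ hτ m
    have hτT : s + τ ≤ T := by linarith [hτ.2]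
    have h₁ := ((hμ α hα).isBoundedFun (add_nonneg hs hτ.1) hτT).abs_weak_term_le h hα.1 hgm hg i m
    have h₂ := ((hμ 0 (by simp)).isBoundedFun (add_nonneg hs hτ.1) hτT).abs_weak_term_le h
      le_rfl hgm hg i m
    simp only [psiA_zero, one_mul] at h₂
    rw [mul_sub]
    exact (abs_sub _ _).trans (add_le_add h₁ h₂)
  · intro m ε hε
    have hBm := h.measurable_testOp hgm i m
    have hB := h.integrable_testOp hgm hg i m
    have hlim := (tendsto_integral_psiA_sub_one_mul (Fin.castAdd m i) hB).const_mul
      (Real.exp ((ϑ₀ + T) * (n + m : ℕ)))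
    rw [mul_zero] at hlim
    filter_upwards [eventually_mem_Icc, hb (n + m) _ hBm hB (ε / 2) (by positivity),
      hlim.eventually_le_const (half_pos hε)] with α hα h₁ h₂ τ hτ
    have hτT : s + τ ≤ T := by linarith [hτ.2]
    have hk := (hμ α hα).isBoundedFun (add_nonneg hs hτ.1) hτT
    have hψB := integrable_psiA_mul_comp hα.1 (Fin.castAdd m i) hB
    have e : (∫ v, k α (s + τ) (n + m) v * (psiA α (v (Fin.castAdd m i)) * testOp a φ g i m v))
          - ∫ v, k 0 (s + τ) (n + m) v * testOp a φ g i m v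
        = corrDiff k α (s + τ) (n + m) (testOp a φ g i m) + ∫ v, k α (s + τ) (n + m) v *
          ((psiA α (v (Fin.castAdd m i)) - 1) * testOp a φ g i m v) := by
      have : ∀ v, k α (s + τ) (n + m) v *
          ((psiA α (v (Fin.castAdd m i)) - 1) * testOp a φ g i m v)
          = k α (s + τ) (n + m) v * (psiA α (v (Fin.castAdd m i)) * testOp a φ g i m v)
            - k α (s + τ) (n + m) v * testOp a φ g i m v := fun v => by ring
      simp only [this]
      rw [integral_sub (hk.integrable_mul hψB) (hk.integrable_mul hB), corrDiff]
      ring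
    have hψB' : Integrable fun v => (psiA α (v (Fin.castAdd m i)) - 1) * testOp a φ g i m v := by
      simp only [sub_mul, one_mul]
      exact hψB.sub hB
    have h₃ := (hk.abs_integral_mul_le hψB').trans h₂
    have h₄ := h₁ τ hτ
    have h₅ : ∫ v, |testOp a φ g i m v| ≤ _ := h.integral_abs_testOp_le hgm hg i m
    have hfac : (1 / (m.factorial : ℝ)) ≤ 1 :=
      div_le_one_of_le₀ (by exact_mod_cast Nat.succ_le_of_lt m.factorial_pos) (by positivity)
    rw [e, abs_mul, abs_of_nonneg (by positivity : (0 : ℝ) ≤ 1 / m.factorial), WBound_eq]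
    calc (1 / (m.factorial : ℝ)) * |_ + _|
        ≤ (1 / (m.factorial : ℝ)) * (c * Real.exp ((ϑ₀ + T + lam * τ) * (n + m : ℕ)) *
            (2 * mayerNorm φ ^ m * ∫ x, |g x|) + ε) := by
          gcongr
          refine (abs_add_le _ _).trans ?_
          have : c * Real.exp ((ϑ₀ + T + lam * τ) * (n + m : ℕ)) * ∫ v, |testOp a φ g i m v|
            ≤ c * Real.exp ((ϑ₀ + T + lam * τ) * (n + m : ℕ)) *
              (2 * mayerNorm φ ^ m * ∫ x, |g x|) := by gcongr
          linarith
      _ ≤ _ := by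
          rw [mul_add]
          exact add_le_add (le_of_eq (by ring)) (mul_le_of_le_one_left hε.le hfac)

/-- The sum over the jumping particle produces a factor `n`, which is matched by the factor `lam *
n` from differentiating the weight. Integrating the differential inequality therefore divides by
`lam`, and the size of `lam` turns this into a gain of 2. -/
theorem ApproxBound.halve (h : ModelAssumptions a φ)
    (hμ : ∀ α ∈ Icc (0 : ℝ) 1, IsStateEvolution a φ α ϑ₀ μ₀ (μ α) (k α))
    {s δ T lam c : ℝ} (hs : 0 ≤ s) (hsT : s + δ ≤ T) (hc : 0 ≤ c)
    (hlam : 4 * Real.exp (Real.exp (ϑ₀ + T + 1) * mayerNorm φ) ≤ lam) (hδ : lam * δ ≤ 1)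
    (hweak : WeaklyConverges k s) (hb : ApproxBound k s δ (ϑ₀ + T) lam c) :
    ApproxBound k s δ (ϑ₀ + T) lam (c / 2) := by
  intro n g hgm hg ε hε
  have hG : 0 ≤ ∫ x, |g x| := integral_nonneg fun _ => abs_nonneg _
  set G := ∫ x, |g x| with hGdef
  have hlam4 : 4 ≤ lam := by
    have := Real.one_le_exp (mul_nonneg (Real.exp_pos (ϑ₀ + T + 1)).le (mayerNorm_nonneg φ))
    linarith
  -- There are `n` jumping particles, so the errors add up to at most `ε/2`; `n + 1` allows `n = 0`.
  -- The other half of `ε` is for the initial time.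
  have hε' : 0 < ε / (2 * (n + 1)) := by positivity
  have h0 := (hweak n g hgm hg).abs
  rw [abs_zero] at h0
  have hall : ∀ᶠ α in 𝓝[>] 0, ∀ i : Fin n, ∀ τ ∈ Icc 0 δ, |∑' m : ℕ, (1 / (m.factorial : ℝ)) *
        ((∫ v, k α (s + τ) (n + m) v * (psiA α (v (Fin.castAdd m i)) * testOp a φ g i m v))
          - ∫ v, k 0 (s + τ) (n + m) v * testOp a φ g i m v)|
      ≤ Real.exp ((ϑ₀ + T + lam * τ) * n) *
          Real.exp (Real.exp (ϑ₀ + T + lam * τ) * mayerNorm φ) * (c * (2 * G))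
            + ε / (2 * (n + 1)) :=
    eventually_all.2 fun i => eventually_abs_tsum_weak_term_le h hμ hs hsT hc hb hgm hg i hε'
  filter_upwards [eventually_mem_Icc, h0.eventually_le_const (half_pos hε), hall]
    with α hα h₁ h₂ τ hτ
  set f : ℝ → ℝ := fun τ => corrDiff k α (s + τ) n g with hf
  set f' : ℝ → ℝ := fun τ => (∫ x, LDelta a φ α (k α (s + τ)) n x * g x)
    - ∫ x, LDelta a φ 0 (k 0 (s + τ)) n x * g x with hf'
  set B : ℝ → ℝ := fun τ => c / 2 * G * Real.exp ((ϑ₀ + T + lam * τ) * n) + ε / 2 * τ with hB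
  have hmaps : MapsTo (fun τ => s + τ) (Icc 0 δ) (Ici 0) := fun τ hτ => add_nonneg hs hτ.1
  have hcont : ContinuousOn f (Icc 0 δ) :=
    (((hμ α hα).continuousOn_integral hg).comp (by fun_prop) hmaps).sub
      (((hμ 0 (by simp)).continuousOn_integral hg).comp (by fun_prop) hmaps)
  have hderiv : ∀ τ ∈ Ioo 0 δ, HasDerivAt f (f' τ) τ := fun τ hτ =>
    (((hμ α hα).hasDerivAt_integral h hα.1 hgm hg (t := s + τ)
      (by linarith [hτ.1])).comp_const_add s τ).sub
    (((hμ 0 (by simp)).hasDerivAt_integral h le_rfl hgm hg (t := s + τ)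
      (by linarith [hτ.1])).comp_const_add s τ)
  have hBd : ∀ τ, HasDerivAt B (c / 2 * G * (Real.exp ((ϑ₀ + T + lam * τ) * n) * (lam * n))
      + ε / 2) τ := by
    intro τ
    have e₁ : HasDerivAt (fun τ : ℝ => (ϑ₀ + T + lam * τ) * n) (lam * n) τ := by
      simpa using (((hasDerivAt_id τ).const_mul lam).const_add (ϑ₀ + T)).mul_const (n : ℝ)
    have e₂ : HasDerivAt (fun τ : ℝ => ε / 2 * τ) (ε / 2) τ := by
      simpa using (hasDerivAt_id τ).const_mul (ε / 2)
    exact (e₁.exp.const_mul _).add e₂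
  have hle : ∀ τ ∈ Ioo 0 δ, |f' τ| ≤ c / 2 * G * (Real.exp ((ϑ₀ + T + lam * τ) * n) * (lam * n))
      + ε / 2 := by
    intro τ hτ
    have hτT : s + τ ≤ T := by linarith [hτ.2]
    have hτ0 : 0 ≤ s + τ := by linarith [hτ.1]
    have hτ1 : lam * τ ≤ 1 := le_trans (by gcongr; exact hτ.2.le) hδ
    rw [hf']
    simp only
    rw [integral_LDelta_sub h ((hμ α hα).isBoundedFun hτ0 hτT)
      ((hμ 0 (by simp)).isBoundedFun hτ0 hτT) hα.1 hgm hg]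
    refine (Finset.abs_sum_le_sum_abs _ _).trans
      ((Finset.sum_le_sum fun i _ => h₂ i τ (Ioo_subset_Icc_self hτ)).trans ?_)
    rw [Finset.sum_const, Finset.card_univ, Fintype.card_fin, nsmul_eq_mul, mul_add]
    -- Because `lam * τ ≤ 1`, the inner exponent stays below `ϑ₀ + T + 1`. In `lam / 4`, one factor
    -- 2 compensates gain and loss, the other halves `c`.
    have e₁ : Real.exp (Real.exp (ϑ₀ + T + lam * τ) * mayerNorm φ) ≤ lam / 4 := by
      have : Real.exp (Real.exp (ϑ₀ + T + lam * τ) * mayerNorm φ)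
          ≤ Real.exp (Real.exp (ϑ₀ + T + 1) * mayerNorm φ) := by
        have := mayerNorm_nonneg φ
        gcongr
      linarith
    have e₂ : (n : ℝ) * (ε / (2 * (n + 1))) ≤ ε / 2 := by
      rw [mul_div_assoc', div_le_div_iff₀ (by positivity) (by positivity)]
      nlinarith
    refine add_le_add ?_ e₂
    calc (n : ℝ) * (Real.exp ((ϑ₀ + T + lam * τ) * n) *
          Real.exp (Real.exp (ϑ₀ + T + lam * τ) * mayerNorm φ) * (c * (2 * G)))
        ≤ (n : ℝ) * (Real.exp ((ϑ₀ + T + lam * τ) * n) * (lam / 4) * (c * (2 * G))) := by gcongr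
      _ = _ := by ring
  have key := abs_sub_le_of_hasDerivAt_le hcont hderiv hBd hle hτ
  have hf0 : |f 0| ≤ ε / 2 := by simpa [hf] using h₁
  -- From `4 ≤ lam` and `lam * δ ≤ 1`; it makes the linear term of `B` at most `ε/2`.
  have hτ1 : τ ≤ 1 := by nlinarith [hτ.1, hτ.2]
  have hB0 : 0 ≤ B 0 := by simp only [hB]; positivity
  have tri : |f τ| ≤ |f τ - f 0| + |f 0| := by
    simpa using abs_add_le (f τ - f 0) (f 0)
  have hBτ : B τ ≤ c / 2 * Real.exp ((ϑ₀ + T + lam * τ) * n) * G + ε / 2 := by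
    simp only [hB]
    nlinarith
  linarith

/-- The range of `α` shrinks with each halving, but the number `N` of halvings is fixed by `ε`
before `α` tends to 0. -/
theorem WeaklyConverges.add (h : ModelAssumptions a φ)
    (hμ : ∀ α ∈ Icc (0 : ℝ) 1, IsStateEvolution a φ α ϑ₀ μ₀ (μ α) (k α))
    {s δ T : ℝ} (hs : 0 ≤ s) (hδ : 0 ≤ δ) (hsT : s + δ ≤ T)
    (hδ1 : 4 * Real.exp (Real.exp (ϑ₀ + T + 1) * mayerNorm φ) * δ ≤ 1)
    (hweak : WeaklyConverges k s) : WeaklyConverges k (s + δ) := by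
  set lam := 4 * Real.exp (Real.exp (ϑ₀ + T + 1) * mayerNorm φ) with hlam
  have hb : ∀ N : ℕ, ApproxBound k s δ (ϑ₀ + T) lam (2 * (1 / 2) ^ N) := by
    intro N
    induction N with
    | zero => simpa using approxBound_two hμ hs hsT (by positivity)
    | succ N ih =>
      have := ih.halve h hμ hs hsT (by positivity) hlam.ge hδ1 hweak
      convert this using 1
      ring
  intro n g hgm hg
  rw [Metric.tendsto_nhds]
  intro ε hε
  have hlim : Tendsto (fun N : ℕ => 2 * (1 / 2 : ℝ) ^ N * Real.exp ((ϑ₀ + T + lam * δ) * n) *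
      ∫ x, |g x|) atTop (𝓝 0) := by
    have := (((tendsto_pow_atTop_nhds_zero_of_lt_one (by norm_num)
      (by norm_num : (1 / 2 : ℝ) < 1)).const_mul 2).mul_const
      (Real.exp ((ϑ₀ + T + lam * δ) * n))).mul_const (∫ x, |g x|)
    simpa using this
  obtain ⟨N, hN⟩ := (hlim.eventually_lt_const (half_pos hε)).exists
  filter_upwards [hb N n g hgm hg (ε / 2) (half_pos hε)] with α hα
  have := hα δ ⟨hδ, le_rfl⟩
  rw [Real.dist_eq, sub_zero]
  linarith

/-- All evolutions start from the same state, and a state determines its correlation functions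
almost everywhere. -/
theorem weaklyConverges_zero
    (hμ : ∀ α ∈ Icc (0 : ℝ) 1, IsStateEvolution a φ α ϑ₀ μ₀ (μ α) (k α)) :
    WeaklyConverges k 0 := by
  intro n g hgm hg
  refine tendsto_const_nhds.congr' ?_
  filter_upwards [eventually_mem_Icc] with α hα
  have hc := (hμ α hα).correlation 0 le_rfl
  have hc0 := (hμ 0 (by simp)).correlation 0 le_rfl
  rw [(hμ α hα).initial, ← (hμ 0 (by simp)).initial] at hc
  have hae : k α 0 n =ᵐ[volume] k 0 0 n := by
    have : (fun x => ENNReal.ofReal (k α 0 n x)) =ᵐ[volume]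
        fun x => ENNReal.ofReal (k 0 0 n x) := by
      refine ae_eq_of_forall_setLIntegral_eq_of_sigmaFinite
        (hc.measurable n).ennreal_ofReal (hc0.measurable n).ennreal_ofReal fun A hA _ => ?_
      have e₁ := hc.density n (A.indicator 1) (measurable_one.indicator hA)
      have e₂ := hc0.density n (A.indicator 1) (measurable_one.indicator hA)
      rw [e₁] at e₂
      have e₃ : ∀ f : (Fin n → Pt d) → ℝ≥0∞,
          ∫⁻ x, A.indicator 1 x * f x = ∫⁻ x in A, f x := fun f => by
        rw [← lintegral_indicator hA]
        refine lintegral_congr fun x => ?_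
        by_cases hx : x ∈ A <;> simp [hx]
      rwa [e₃, e₃] at e₂
    filter_upwards [this] with x hx
    rwa [ENNReal.ofReal_eq_ofReal_iff (hc.nonneg n x) (hc0.nonneg n x)] at hx
  rw [corrDiff, eq_comm, sub_eq_zero]
  refine integral_congr_ae ?_
  filter_upwards [hae] with x hx
  rw [hx]

theorem weaklyConverges (h : ModelAssumptions a φ)
    (hμ : ∀ α ∈ Icc (0 : ℝ) 1, IsStateEvolution a φ α ϑ₀ μ₀ (μ α) (k α))
    {t : ℝ} (ht : 0 ≤ t) : WeaklyConverges k t := by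
  set lam := 4 * Real.exp (Real.exp (ϑ₀ + t + 1) * mayerNorm φ) with hlam
  -- With the horizon fixed at `t`, the same `lam` serves every step; `J` steps of length `t / J`
  -- satisfy `lam * (t / J) ≤ 1`.
  obtain ⟨J, hJ⟩ := exists_nat_gt (lam * t)
  have hlampos : 0 < lam := by positivity
  have hJ0 : (0 : ℝ) < J := (mul_nonneg hlampos.le ht).trans_lt hJ
  have step : ∀ j : ℕ, j ≤ J → WeaklyConverges k (j * (t / J)) := by
    intro j
    induction j with
    | zero => intro _; simpa using weaklyConverges_zero hμ
    | succ j ih =>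
      intro hj
      have := (ih (by omega)).add h hμ (δ := t / J) (T := t) (by positivity) (by positivity) ?_ ?_
      · convert this using 1
        push_cast
        ring
      · have : ((j : ℝ) + 1) ≤ J := by exact_mod_cast hj
        calc (j : ℝ) * (t / J) + t / J = (j + 1) * (t / J) := by ring
          _ ≤ J * (t / J) := by gcongr
          _ = t := by field_simp
      · rw [← hlam, mul_div_assoc', div_le_one hJ0]
        exact hJ.le
  have := step J le_rfl
  rwa [mul_div_cancel₀ _ hJ0.ne'] at this

/-- Convergence of the pairings with the functions in `𝒢_ϑ`. -/
theorem tendsto_pairing (h : ModelAssumptions a φ)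
    (hμ : ∀ α ∈ Icc (0 : ℝ) 1, IsStateEvolution a φ α ϑ₀ μ₀ (μ α) (k α))
    {t : ℝ} (ht : 0 ≤ t) {ϑ : ℝ} (hϑ : ϑ₀ + t ≤ ϑ) {G : FinFun d} (hGm : ∀ n, Measurable (G n))
    (hG : gNorm ϑ G < ∞) :
    Tendsto (fun α => pairing (k α t) G) (𝓝[>] 0) (𝓝 (pairing (k 0 t) G)) := by
  have hterm : ∀ n : ℕ, ENNReal.ofReal (Real.exp (ϑ * n) / (n.factorial : ℝ)) *
      eLpNorm (G n) 1 volume ≠ ∞ := ENNReal.ne_top_of_tsum_ne_top hG.ne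
  have hGi : ∀ n, Integrable (G n) := fun n => by
    refine memLp_one_iff_integrable.1 ⟨(hGm n).aestronglyMeasurable, lt_top_iff_ne_top.2 fun e => ?_⟩
    refine hterm n ?_
    rw [e, ENNReal.mul_top]
    simp only [ne_eq, ENNReal.ofReal_eq_zero, not_le]
    positivity
  have hsum : Summable fun n : ℕ => (1 / (n.factorial : ℝ)) *
      (Real.exp (ϑ * n) * ∫ x, |G n x|) := by
    have := ENNReal.summable_toReal hG.ne
    refine this.congr fun n => ?_
    rw [ENNReal.toReal_mul, ENNReal.toReal_ofReal (by positivity), eLpNorm_one_eq_lintegral_enorm,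
      ← integral_norm_eq_lintegral_enorm (hGi n).aestronglyMeasurable]
    simp only [Real.norm_eq_abs]
    ring
  -- The bound `e^{(ϑ₀+t)n}` on the correlation functions, uniform in `α`, makes the terms of `gNorm
  -- ϑ G` a majorant.
  refine tendsto_tsum_of_dominated_convergence hsum (fun n => ?_) ?_
  · have h₁ := (weaklyConverges h hμ ht n (G n) (hGm n) (hGi n)).add_const
      (∫ x, k 0 t n x * G n x)
    simp only [corrDiff, sub_add_cancel, zero_add] at h₁
    exact h₁.const_mul _
  · filter_upwards [eventually_mem_Icc] with α hα n
    rw [norm_mul, Real.norm_of_nonneg (by positivity)]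
    gcongr
    refine (((hμ α hα).isBoundedFun ht le_rfl).abs_integral_mul_le (hGi n)).trans ?_
    have : 0 ≤ ∫ x, |G n x| := integral_nonneg fun _ => abs_nonneg _
    gcongr

end Convergence

/-! ### The topology of the space of tempered configurations -/

section ConfigTopology

open scoped BoundedContinuousFunction

variable {d : ℕ}

theorem psi_pos (x : Pt d) : 0 < psi x := by
  unfold psi psiA; positivity

theorem TemperedConfig.summable_mul (γ : TemperedConfig d) {g : Pt d → ℝ} {C : ℝ}
    (hg : ∀ x, |g x| ≤ C * psi x) : Summable fun x => (γ.mult x : ℝ) * g x := by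
  refine (γ.tempered.mul_left C).of_norm_bounded fun x => ?_
  rw [norm_mul, Real.norm_eq_abs, Real.norm_eq_abs, Nat.abs_cast, mul_left_comm]
  exact mul_le_mul_of_nonneg_left (hg x) (Nat.cast_nonneg _)

theorem abs_mul_psi_le (g : Pt d →ᵇ ℝ) (x : Pt d) : |g x * psi x| ≤ ‖g‖ * psi x := by
  rw [abs_mul, abs_of_pos (psi_pos x)]
  exact mul_le_mul_of_nonneg_right (g.norm_coe_le_norm x) (psi_pos x).le

theorem TemperedConfig.summable (γ : TemperedConfig d) (g : Pt d →ᵇ ℝ) :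
    Summable fun x => (γ.mult x : ℝ) * (g x * psi x) :=
  γ.summable_mul (abs_mul_psi_le g)

theorem TemperedConfig.sum_add (γ : TemperedConfig d) (g g' : Pt d →ᵇ ℝ) :
    (γ.sum fun x => (g + g') x * psi x)
      = (γ.sum fun x => g x * psi x) + γ.sum fun x => g' x * psi x := by
  rw [TemperedConfig.sum, TemperedConfig.sum, TemperedConfig.sum,
    ← (γ.summable g).tsum_add (γ.summable g')]
  refine tsum_congr fun x => ?_
  rw [BoundedContinuousFunction.add_apply]
  ring

theorem TemperedConfig.sum_const_mul (γ : TemperedConfig d) (c : ℝ) (g : Pt d → ℝ) :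
    (γ.sum fun x => c * g x) = c * γ.sum g := by
  rw [TemperedConfig.sum, TemperedConfig.sum, ← tsum_mul_left]
  exact tsum_congr fun x => by ring

theorem TemperedConfig.sum_nonneg (γ : TemperedConfig d) {g : Pt d → ℝ} (hg : ∀ x, 0 ≤ g x) :
    0 ≤ γ.sum g :=
  tsum_nonneg fun x => mul_nonneg (Nat.cast_nonneg _) (hg x)

/-- A continuous cutoff function, supported in the ball of radius `j`. -/
noncomputable def cutoff (d j : ℕ) : Pt d →ᵇ ℝ :=
  BoundedContinuousFunction.ofNormedAddCommGroup (fun x => max 0 (min 1 ((j : ℝ) - ‖x‖)))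
    (by fun_prop) 1 fun x => by
      rw [Real.norm_eq_abs, abs_of_nonneg (le_max_left _ _)]
      exact max_le zero_le_one (min_le_left _ _)

theorem cutoff_apply (j : ℕ) (x : Pt d) : cutoff d j x = max 0 (min 1 ((j : ℝ) - ‖x‖)) := rfl

theorem cutoff_nonneg (j : ℕ) (x : Pt d) : 0 ≤ cutoff d j x := le_max_left _ _

theorem cutoff_le_one (j : ℕ) (x : Pt d) : cutoff d j x ≤ 1 :=
  max_le zero_le_one (min_le_left _ _)

theorem cutoff_eq_zero {j : ℕ} {x : Pt d} (hx : x ∉ Metric.closedBall 0 (j : ℝ)) :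
    cutoff d j x = 0 := by
  rw [Metric.mem_closedBall, dist_zero_right, not_le] at hx
  rw [cutoff_apply, max_eq_left]
  exact (min_le_right _ _).trans (by linarith)

theorem tendsto_cutoff (x : Pt d) : Tendsto (fun j => cutoff d j x) atTop (𝓝 1) := by
  refine tendsto_const_nhds.congr' ?_
  obtain ⟨J, hJ⟩ := exists_nat_ge (‖x‖ + 1)
  filter_upwards [eventually_ge_atTop J] with j hj
  have : (J : ℝ) ≤ j := by exact_mod_cast hj
  rw [cutoff_apply, min_eq_left (by linarith), max_eq_right zero_le_one]

theorem TemperedConfig.tendsto_sum_cutoff (γ : TemperedConfig d) :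
    Tendsto (fun j => γ.sum fun x => cutoff d j x * psi x) atTop (𝓝 (γ.sum psi)) := by
  refine tendsto_tsum_of_dominated_convergence γ.tempered (fun x => ?_)
    (Eventually.of_forall fun j x => ?_)
  · simpa using ((tendsto_cutoff x).mul_const (psi x)).const_mul (γ.mult x : ℝ)
  · have h₀ := (psi_pos x).le
    have h₁ := cutoff_nonneg j x
    rw [Real.norm_of_nonneg (by positivity)]
    gcongr
    exact mul_le_of_le_one_left h₀ (cutoff_le_one j x)

theorem exists_bound_cutoff_mul (j : ℕ) (p : C(Pt d, ℝ)) :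
    ∃ C, ∀ x, ‖cutoff d j x * |p x|‖ ≤ C := by
  refine Continuous.bounded_above_of_compact_support (by fun_prop)
    (HasCompactSupport.intro (isCompact_closedBall 0 (j : ℝ)) fun x hx => ?_)
  rw [cutoff_eq_zero hx, zero_mul]

/-- A countable family of nonnegative functions which determines the topology of `Γ_*`. -/
noncomputable def testFamily (d : ℕ) : Option (ℕ × Option ℕ) → Pt d →ᵇ ℝ
  | none => 1
  | some (j, none) => cutoff d j
  | some (j, some l) => BoundedContinuousFunction.ofNormedAddCommGroup
      (fun x => cutoff d j x * |TopologicalSpace.denseSeq C(Pt d, ℝ) l x|) (by fun_prop)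
      _ (exists_bound_cutoff_mul j (TopologicalSpace.denseSeq C(Pt d, ℝ) l)).choose_spec

theorem testFamily_nonneg (d : ℕ) (i : Option (ℕ × Option ℕ)) (x : Pt d) :
    0 ≤ testFamily d i x := by
  match i with
  | none => exact zero_le_one
  | some (j, none) => exact cutoff_nonneg j x
  | some (j, some l) => exact mul_nonneg (cutoff_nonneg j x) (abs_nonneg _)

theorem exists_denseSeq_near (g : C(Pt d, ℝ)) (j : ℕ) {ε : ℝ} (hε : 0 < ε) :
    ∃ l, ∀ x ∈ Metric.closedBall (0 : Pt d) (j : ℝ),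
      |g x - TopologicalSpace.denseSeq C(Pt d, ℝ) l x| < ε := by
  have h₁ := Metric.tendstoUniformlyOn_iff.1
    (ContinuousMap.tendsto_iff_forall_isCompact_tendstoUniformlyOn.1
      (tendsto_id (x := 𝓝 g)) _ (isCompact_closedBall 0 (j : ℝ))) ε hε
  obtain ⟨_, h₂, l, rfl⟩ := mem_closure_iff_nhds.1
    (TopologicalSpace.denseRange_denseSeq C(Pt d, ℝ) g) _ h₁
  exact ⟨l, h₂⟩

/-- For `g ≥ 0`, approximate `g` on a large ball by a member of the dense sequence. The mass `∑ (1 -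
cutoff) ψ` outside is small at the given point and stays small nearby, being a difference of two
sums over members of the family; for this the family contains the constant 1. -/
theorem continuous_sum_of_testFamily {X : Type*} [TopologicalSpace X] {Γ : X → TemperedConfig d}
    (hΓ : ∀ i, Continuous fun p => (Γ p).sum fun x => testFamily d i x * psi x)
    (g : Pt d →ᵇ ℝ) : Continuous fun p => (Γ p).sum fun x => g x * psi x := by
  have hone : Continuous fun p => (Γ p).sum psi := by
    simpa [testFamily] using hΓ none
  have hcut : ∀ j, Continuous fun p => (Γ p).sum fun x => cutoff d j x * psi x :=
    fun j => hΓ (some (j, none))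
  have main : ∀ g : Pt d →ᵇ ℝ, (∀ x, 0 ≤ g x) →
      Continuous fun p => (Γ p).sum fun x => g x * psi x := by
    intro g hg
    refine continuous_iff_continuousAt.2 fun p₀ =>
      continuousAt_of_locally_uniform_approx_of_continuousAt fun u hu => ?_
    obtain ⟨η, hη, hηu⟩ := Metric.mem_uniformity_dist.1 hu
    have hs₀ : 0 ≤ (Γ p₀).sum psi := (Γ p₀).sum_nonneg fun x => (psi_pos x).le
    -- The total error is at most `‖g‖ ε` from the tail and `ε ((Γ p₀).sum psi + 1)` from the
    -- approximation on the ball, together `ε D`.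
    set D := ‖g‖ + (Γ p₀).sum psi + 1 with hD
    have hDpos : 0 < D := by positivity
    set ε := η / (2 * D) with hε
    have hεpos : 0 < ε := by positivity
    obtain ⟨j, hj⟩ := (((Γ p₀).tendsto_sum_cutoff.const_sub ((Γ p₀).sum psi)).eventually_lt_const
      (u := ε) (by simpa using hεpos)).exists
    obtain ⟨l, hl⟩ := exists_denseSeq_near g.toContinuousMap j hεpos
    have ev₁ := (hone.sub (hcut j)).continuousAt.eventually_lt_const hj
    have ev₂ := hone.continuousAt.eventually_lt_const (lt_add_one ((Γ p₀).sum psi))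
    refine ⟨_, ev₁.and ev₂, _, (hΓ (some (j, some l))).continuousAt, ?_⟩
    rintro p ⟨hp₁, hp₂⟩
    refine hηu ?_
    rw [Real.dist_eq]
    have hpt : ∀ x, |g x - testFamily d (some (j, some l)) x|
        ≤ ‖g‖ * (1 - cutoff d j x) + ε := by
      intro x
      have e : testFamily d (some (j, some l)) x
        = cutoff d j x * |TopologicalSpace.denseSeq C(Pt d, ℝ) l x| := rfl
      have hgx : g x ≤ ‖g‖ := (le_abs_self _).trans (g.norm_coe_le_norm x)
      have h₀ := cutoff_nonneg j x
      have h₁ := cutoff_le_one j x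
      by_cases hx : x ∈ Metric.closedBall (0 : Pt d) (j : ℝ)
      · have h₂ := hl x hx
        -- As `g ≥ 0`, taking the absolute value of the approximant does not worsen the
        -- approximation.
        have h₃ : abs (g x - |TopologicalSpace.denseSeq C(Pt d, ℝ) l x|) ≤ ε := by
          refine le_trans ?_ h₂.le
          have := abs_abs_sub_abs_le_abs_sub (g x) (TopologicalSpace.denseSeq C(Pt d, ℝ) l x)
          rwa [abs_of_nonneg (hg x)] at this
        rw [e]
        set q := |TopologicalSpace.denseSeq C(Pt d, ℝ) l x|
        have : g x - cutoff d j x * q = g x * (1 - cutoff d j x) + cutoff d j x * (g x - q) := by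
          ring
        rw [this]
        refine (abs_add_le _ _).trans (add_le_add ?_ ?_)
        · rw [abs_of_nonneg (mul_nonneg (hg x) (by linarith))]
          exact mul_le_mul_of_nonneg_right hgx (by linarith)
        · rw [abs_mul, abs_of_nonneg h₀]
          exact (mul_le_of_le_one_left (abs_nonneg _) h₁).trans h₃
      · rw [e, cutoff_eq_zero hx]
        simp only [zero_mul, sub_zero, mul_one]
        rw [abs_of_nonneg (hg x)]
        linarith
    have hsub : ((Γ p).sum fun x => g x * psi x)
        - (Γ p).sum (fun x => testFamily d (some (j, some l)) x * psi x)
        = ∑' x, ((Γ p).mult x : ℝ) * ((g x - testFamily d (some (j, some l)) x) * psi x) := by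
      rw [TemperedConfig.sum, TemperedConfig.sum, ← ((Γ p).summable g).tsum_sub ((Γ p).summable _)]
      exact tsum_congr fun x => by ring
    have hbd : HasSum (fun x => ((Γ p).mult x : ℝ) * ((‖g‖ * (1 - cutoff d j x) + ε) * psi x))
        (‖g‖ * ((Γ p).sum psi - (Γ p).sum fun x => cutoff d j x * psi x) + ε * (Γ p).sum psi) := by
      have s₁ : HasSum (fun x => ((Γ p).mult x : ℝ) * psi x) ((Γ p).sum psi) :=
        (Γ p).tempered.hasSum
      have s₂ : HasSum (fun x => ((Γ p).mult x : ℝ) * (cutoff d j x * psi x))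
        ((Γ p).sum fun x => cutoff d j x * psi x) := ((Γ p).summable (cutoff d j)).hasSum
      have s₃ := ((s₁.sub s₂).mul_left ‖g‖).add (s₁.mul_left ε)
      have e : (fun x => ((Γ p).mult x : ℝ) * ((‖g‖ * (1 - cutoff d j x) + ε) * psi x))
          = fun x => ‖g‖ * ((Γ p).mult x * psi x - (Γ p).mult x * (cutoff d j x * psi x))
            + ε * ((Γ p).mult x * psi x) := funext fun x => by ring
      rwa [e]
    rw [hsub]
    have := tsum_of_norm_bounded hbd (f := fun x => ((Γ p).mult x : ℝ) *
      ((g x - testFamily d (some (j, some l)) x) * psi x)) fun x => by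
        rw [norm_mul, norm_mul, Real.norm_of_nonneg (Nat.cast_nonneg _),
          Real.norm_of_nonneg (psi_pos x).le]
        have := (psi_pos x).le
        gcongr
        exact hpt x
    rw [Real.norm_eq_abs] at this
    refine this.trans_lt ?_
    have hp₁' : (Γ p).sum psi - (Γ p).sum (fun x => cutoff d j x * psi x) < ε := hp₁
    have hp₂' : (Γ p).sum psi < (Γ p₀).sum psi + 1 := hp₂
    calc _ ≤ ‖g‖ * ε + ε * ((Γ p₀).sum psi + 1) := by gcongr
      _ = ε * D := by rw [hD]; ring
      _ = η / 2 := by rw [hε]; field_simp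
      _ < η := half_lt_self hη
  -- A general `g` is made nonnegative by adding the constant `‖g‖`, whose sum is continuous.
  have hpos : ∀ x, 0 ≤ (g + BoundedContinuousFunction.const (Pt d) ‖g‖) x := fun x => by
    have := (abs_le.1 (g.norm_coe_le_norm x)).1
    simp only [BoundedContinuousFunction.add_apply, BoundedContinuousFunction.const_apply]
    linarith
  have h₁ := (main _ hpos).sub (hone.const_mul ‖g‖)
  refine h₁.congr fun p => ?_
  rw [Pi.sub_apply, TemperedConfig.sum_add]
  simp only [BoundedContinuousFunction.const_apply, TemperedConfig.sum_const_mul]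
  ring

theorem continuous_sum (g : Pt d →ᵇ ℝ) :
    Continuous fun γ : TemperedConfig d => γ.sum fun x => g x * psi x :=
  continuous_iff_le_induced.2 (iInf_le _ g)

/-- The embedding `γ ↦ (exp(-∑_{x ∈ γ} f_i(x) ψ(x)))_i` of `Γ_*` into a compact cube. -/
noncomputable def cubeMap (d : ℕ) (γ : TemperedConfig d) (i : Option (ℕ × Option ℕ)) :
    unitInterval :=
  ⟨Real.exp (-γ.sum fun x => testFamily d i x * psi x), (Real.exp_pos _).le,
    Real.exp_le_one_iff.2 (neg_nonpos.2 (γ.sum_nonneg fun x =>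
      mul_nonneg (testFamily_nonneg d i x) (psi_pos x).le))⟩

/-- The sums over the test family are recovered from the coordinates by `-log`, and they determine
all the sums that define the topology. -/
theorem isInducing_cubeMap (d : ℕ) : Topology.IsInducing (cubeMap d) := by
  refine ⟨le_antisymm (continuous_iff_le_induced.1 ?_) (le_iInf fun g => ?_)⟩
  · exact continuous_pi fun i => ((continuous_sum (testFamily d i)).neg.rexp).subtype_mk _
  · refine @Continuous.le_induced (TemperedConfig d) ℝ
      (TopologicalSpace.induced (cubeMap d) inferInstance) _ _ ?_
    let t : TopologicalSpace (TemperedConfig d) :=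
      TopologicalSpace.induced (cubeMap d) inferInstance
    refine @continuous_sum_of_testFamily d (TemperedConfig d) t id (fun i => ?_) g
    have h₁ : @Continuous _ _ t _ (cubeMap d) := continuous_induced_dom
    have h₂ : @Continuous _ _ t _ fun γ => (cubeMap d γ i : ℝ) :=
      (show Continuous fun p : Option (ℕ × Option ℕ) → unitInterval => (p i : ℝ) by
        fun_prop).comp h₁
    have h₃ := (@Continuous.log _ t _ h₂ fun γ => (Real.exp_pos _).ne').neg
    refine h₃.congr fun γ => ?_
    simp [cubeMap]

theorem measurable_cubeMap (d : ℕ) : Measurable (cubeMap d) :=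
  (isInducing_cubeMap d).continuous.measurable

/-! ### A criterion for weak convergence on the space of tempered configurations -/

theorem exists_sum_of_mem_closure {F : C(Option (ℕ × Option ℕ) → unitInterval, ℝ)}
    (hF : F ∈ Submonoid.closure (range fun i =>
      (⟨fun p : Option (ℕ × Option ℕ) → unitInterval => (p i : ℝ), by fun_prop⟩ :
        C(Option (ℕ × Option ℕ) → unitInterval, ℝ)))) :
    ∃ g : Pt d →ᵇ ℝ, (∀ x, 0 ≤ g x) ∧
      ∀ γ, F (cubeMap d γ) = Real.exp (-γ.sum fun x => g x * psi x) := by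
  induction hF using Submonoid.closure_induction with
  | mem F hF =>
    obtain ⟨i, rfl⟩ := hF
    exact ⟨testFamily d i, testFamily_nonneg d i, fun γ => rfl⟩
  | one => exact ⟨0, fun x => le_rfl, fun γ => by simp [TemperedConfig.sum]⟩
  | mul F F' _ _ ih ih' =>
    obtain ⟨g, hg, e⟩ := ih
    obtain ⟨g', hg', e'⟩ := ih'
    refine ⟨g + g', fun x => add_nonneg (hg x) (hg' x), fun γ => ?_⟩
    rw [TemperedConfig.sum_add, neg_add, Real.exp_add, ← e, ← e']
    rfl

/-- A product of coordinates is again of the form `exp(-∑ g ψ)`, so the hypothesis covers the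
algebra they generate by linearity. This algebra separates points, hence is dense by
Stone-Weierstrass. -/
theorem tendsto_integral_cubeMap {A : Type*} {l : Filter A}
    {ν : A → ProbabilityMeasure (TemperedConfig d)} {ν₀ : ProbabilityMeasure (TemperedConfig d)}
    (hν : ∀ g : Pt d →ᵇ ℝ, (∀ x, 0 ≤ g x) →
      Tendsto (fun α => ∫ γ : TemperedConfig d, Real.exp (-γ.sum fun x => g x * psi x) ∂(ν α)) l
        (𝓝 (∫ γ : TemperedConfig d, Real.exp (-γ.sum fun x => g x * psi x) ∂ν₀)))
    (F : C(Option (ℕ × Option ℕ) → unitInterval, ℝ)) :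
    Tendsto (fun α => ∫ γ, F (cubeMap d γ) ∂(ν α)) l (𝓝 (∫ γ, F (cubeMap d γ) ∂ν₀)) := by
  have hint : ∀ (F : C(Option (ℕ × Option ℕ) → unitInterval, ℝ))
      (ρ : ProbabilityMeasure (TemperedConfig d)),
      Integrable (fun γ => F (cubeMap d γ)) (ρ : Measure (TemperedConfig d)) := fun F ρ =>
    Integrable.of_bound (F.continuous.measurable.comp (measurable_cubeMap d)).aestronglyMeasurable
      ‖F‖ (ae_of_all _ fun γ => F.norm_coe_le_norm _)
  set S : Set C(Option (ℕ × Option ℕ) → unitInterval, ℝ) := range fun i =>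
      (⟨fun p : Option (ℕ × Option ℕ) → unitInterval => (p i : ℝ), by fun_prop⟩ :
        C(Option (ℕ × Option ℕ) → unitInterval, ℝ)) with hS
  have hadjoin : ∀ F ∈ Algebra.adjoin ℝ S,
      Tendsto (fun α => ∫ γ, F (cubeMap d γ) ∂(ν α)) l (𝓝 (∫ γ, F (cubeMap d γ) ∂ν₀)) := by
    intro F hF
    rw [← Subalgebra.mem_toSubmodule, Algebra.adjoin_eq_span] at hF
    induction hF using Submodule.span_induction with
    | mem F hF =>
      obtain ⟨g, hg, e⟩ := exists_sum_of_mem_closure (d := d) hF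
      simpa only [e] using hν g hg
    | zero =>
      simp only [ContinuousMap.zero_apply, integral_zero]
      exact tendsto_const_nhds
    | add F F' _ _ ih ih' =>
      simp only [ContinuousMap.add_apply, integral_add (hint F _) (hint F' _)]
      exact ih.add ih'
    | smul c F _ ih =>
      simp only [ContinuousMap.smul_apply, integral_smul]
      exact ih.const_smul c
  have hsep : (Algebra.adjoin ℝ S).SeparatesPoints := by
    intro p q hpq
    obtain ⟨i, hi⟩ := Function.ne_iff.1 hpq
    exact ⟨_, ⟨_, Algebra.subset_adjoin ⟨i, rfl⟩, rfl⟩, fun e => hi (Subtype.ext e)⟩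
  have hdense := ContinuousMap.subalgebra_topologicalClosure_eq_top_of_separatesPoints _ hsep
  have hFcl : F ∈ closure (Algebra.adjoin ℝ S : Set C(Option (ℕ × Option ℕ) → unitInterval, ℝ)) := by
    rw [← Subalgebra.topologicalClosure_coe, hdense]; trivial
  rw [Metric.tendsto_nhds]
  intro ε hε
  obtain ⟨F', hF', hFF'⟩ := Metric.mem_closure_iff.1 hFcl (ε / 3) (by positivity)
  have hclose : ∀ ρ : ProbabilityMeasure (TemperedConfig d),
      |(∫ γ, F (cubeMap d γ) ∂ρ) - ∫ γ, F' (cubeMap d γ) ∂ρ| ≤ ε / 3 := by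
    intro ρ
    rw [← integral_sub (hint F ρ) (hint F' ρ), ← Real.norm_eq_abs]
    refine (norm_integral_le_of_norm_le_const (C := ε / 3) (ae_of_all _ fun γ => ?_)).trans_eq
      (by simp)
    rw [← dist_eq_norm]
    exact (ContinuousMap.dist_apply_le_dist _).trans hFF'.le
  filter_upwards [(Metric.tendsto_nhds.1 (hadjoin F' hF')) (ε / 3) (by positivity)] with α hα
  rw [Real.dist_eq] at hα ⊢
  have h₁ := abs_le.1 (hclose (ν α))
  have h₂ := abs_le.1 (hclose ν₀)
  have h₃ := abs_lt.1 hα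
  rw [abs_lt]
  constructor <;> linarith [h₁.1, h₁.2, h₂.1, h₂.2, h₃.1, h₃.2]

/-- Every open set of `Γ_*` is the preimage of an open set of the cube, so the lower bounds of the
portmanteau theorem pass from the image measures to the original ones. The image need not be closed.
-/
theorem tendsto_of_tendsto_integral_exp {A : Type*} {l : Filter A} [l.IsCountablyGenerated]
    {ν : A → ProbabilityMeasure (TemperedConfig d)} {ν₀ : ProbabilityMeasure (TemperedConfig d)}
    (hν : ∀ g : Pt d →ᵇ ℝ, (∀ x, 0 ≤ g x) →
      Tendsto (fun α => ∫ γ : TemperedConfig d, Real.exp (-γ.sum fun x => g x * psi x) ∂(ν α)) l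
        (𝓝 (∫ γ : TemperedConfig d, Real.exp (-γ.sum fun x => g x * psi x) ∂ν₀))) :
    Tendsto ν l (𝓝 ν₀) := by
  have hmap : Tendsto (fun α => (ν α).map (measurable_cubeMap d).aemeasurable) l
      (𝓝 (ν₀.map (measurable_cubeMap d).aemeasurable)) := by
    refine ProbabilityMeasure.tendsto_iff_forall_integral_tendsto.2 fun F => ?_
    have := tendsto_integral_cubeMap hν F.toContinuousMap
    have e : ∀ ρ : ProbabilityMeasure (TemperedConfig d),
        ∫ p, F p ∂(ρ.map (measurable_cubeMap d).aemeasurable :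
          Measure (Option (ℕ × Option ℕ) → unitInterval)) = ∫ γ, F (cubeMap d γ) ∂ρ := fun ρ => by
      rw [ProbabilityMeasure.toMeasure_map,
        integral_map (measurable_cubeMap d).aemeasurable
          F.continuous.measurable.aestronglyMeasurable]
    simp only [e]
    exact this
  refine tendsto_of_forall_isOpen_le_liminf' fun U hU => ?_
  obtain ⟨V, hV, rfl⟩ := (isInducing_cubeMap d).isOpen_iff.1 hU
  have := ProbabilityMeasure.le_liminf_measure_open_of_tendsto hmap hV
  simpa only [ProbabilityMeasure.toMeasure_map,
    Measure.map_apply (measurable_cubeMap d) hV.measurableSet] using this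

end ConfigTopology

/-! ### Factorial sums of products -/

section FactorialSum

open Classical

variable {d : ℕ}

theorem factorialSum_const_mul (n : ℕ) (m : Pt d → ℕ) (c : ℝ≥0∞)
    (g : (Fin n → Pt d) → ℝ≥0∞) :
    factorialSum n m (fun x => c * g x) = c * factorialSum n m g := by
  induction n generalizing m with
  | zero => rfl
  | succ n ih =>
    simp only [factorialSum, ih, ← ENNReal.tsum_mul_left]
    exact tsum_congr fun x => mul_left_comm _ _ _

/-- The sum `∑ h(x₁) ⋯ h(xₙ)` over the `n`-tuples of different points of a configuration. -/
noncomputable def factorialPower (h : Pt d → ℝ≥0∞) (n : ℕ) (m : Pt d → ℕ) : ℝ≥0∞ :=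
  factorialSum n m fun x => ∏ j, h (x j)

/-- The configuration with one point fewer at `x`. -/
noncomputable def removePt (m : Pt d → ℕ) (x : Pt d) : Pt d → ℕ := Function.update m x (m x - 1)

/-- The configuration with one point more at `x`. -/
noncomputable def addPt (m : Pt d → ℕ) (x : Pt d) : Pt d → ℕ := Function.update m x (m x + 1)

theorem removePt_addPt (m : Pt d → ℕ) (x : Pt d) : removePt (addPt m x) x = m := by
  simp [removePt, addPt]

theorem addPt_removePt {m : Pt d → ℕ} {x : Pt d} (hx : m x ≠ 0) : addPt (removePt m x) x = m := by
  have : m x - 1 + 1 = m x := Nat.succ_pred_eq_of_ne_zero hx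
  simp [removePt, addPt, this]

theorem removePt_addPt_comm {m : Pt d → ℕ} {x y : Pt d} (hy : m y ≠ 0) :
    removePt (addPt m x) y = addPt (removePt m y) x := by
  by_cases hxy : x = y
  · subst hxy; rw [removePt_addPt, addPt_removePt hy]
  · have hyx : y ≠ x := Ne.symm hxy
    simp [removePt, addPt, Function.update_of_ne hxy, Function.update_of_ne hyx,
      Function.update_comm hxy]

theorem addPt_apply (m : Pt d → ℕ) (x y : Pt d) :
    ((addPt m x y : ℕ) : ℝ≥0∞) = m y + if y = x then 1 else 0 := by
  by_cases hyx : y = x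
  · subst hyx; simp [addPt]
  · simp [addPt, hyx]

variable (h : Pt d → ℝ≥0∞)

theorem factorialPower_zero (m : Pt d → ℕ) : factorialPower h 0 m = 1 := by
  simp [factorialPower, factorialSum]

theorem factorialPower_succ (n : ℕ) (m : Pt d → ℕ) :
    factorialPower h (n + 1) m = ∑' x, (m x : ℝ≥0∞) * (h x * factorialPower h n (removePt m x)) := by
  simp only [factorialPower, factorialSum, Fin.prod_univ_succ, Fin.cons_zero, Fin.cons_succ,
    factorialSum_const_mul, removePt]

/-- An `(n+1)`-tuple either avoids the added point or uses it in exactly one of `n + 1` positions.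
-/
theorem factorialPower_addPt (n : ℕ) (m : Pt d → ℕ) (x : Pt d) :
    factorialPower h (n + 1) (addPt m x)
      = factorialPower h (n + 1) m + (n + 1) * h x * factorialPower h n m := by
  induction n generalizing m with
  | zero =>
    simp only [factorialPower_succ, factorialPower_zero, addPt_apply, add_mul, ENNReal.tsum_add,
      ite_mul, one_mul, zero_mul, tsum_ite_eq]
    simp
  | succ n ih =>
    have e : ∀ y, (addPt m x y : ℝ≥0∞) * (h y * factorialPower h (n + 1) (removePt (addPt m x) y))
        = (m y : ℝ≥0∞) * (h y * factorialPower h (n + 1) (removePt m y))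
          + (n + 1) * h x * ((m y : ℝ≥0∞) * (h y * factorialPower h n (removePt m y)))
          + if y = x then h x * factorialPower h (n + 1) m else 0 := by
      intro y
      rw [addPt_apply, add_mul]
      congr 1
      · by_cases hy : m y = 0
        · simp [hy]
        · rw [removePt_addPt_comm hy, ih]
          ring
      · by_cases hyx : y = x
        · subst hyx; simp [removePt_addPt]
        · simp [hyx]
    rw [factorialPower_succ h (n + 1) (addPt m x)]
    simp only [e]
    rw [ENNReal.tsum_add, ENNReal.tsum_add, ENNReal.tsum_mul_left, tsum_ite_eq,
      ← factorialPower_succ, ← factorialPower_succ]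
    push_cast
    ring

theorem factorialPower_congr {m m' : Pt d → ℕ} (hm : ∀ x, h x ≠ 0 → m x = m' x) (n : ℕ) :
    factorialPower h n m = factorialPower h n m' := by
  induction n generalizing m m' with
  | zero => rw [factorialPower_zero, factorialPower_zero]
  | succ n ih =>
    rw [factorialPower_succ, factorialPower_succ]
    refine tsum_congr fun x => ?_
    by_cases hx : h x = 0
    · simp [hx]
    · rw [hm x hx, ih (m := removePt m x) (m' := removePt m' x) fun y hy => ?_]
      by_cases hyx : y = x
      · subst hyx; simp [removePt, hm y hy]
      · simp [removePt, hyx, hm y hy]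

theorem factorialPower_le (n : ℕ) (m : Pt d → ℕ) :
    factorialPower h n m ≤ (∑' x, (m x : ℝ≥0∞) * h x) ^ n := by
  induction n generalizing m with
  | zero => simp [factorialPower_zero]
  | succ n ih =>
    rw [factorialPower_succ, pow_succ', ← ENNReal.tsum_mul_right]
    refine ENNReal.tsum_le_tsum fun x => ?_
    rw [← mul_assoc]
    gcongr
    refine (ih _).trans ?_
    gcongr with y
    by_cases hyx : y = x
    · subst hyx; simp [removePt]
    · simp [removePt, hyx]

/-- The sum `∑_{y ∈ m} h(y)^{p+1} ∑ h(x₁) ⋯ h(xₙ)`, the inner sum being over the `n`-tuples of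
different points of `m ∖ y`. -/
noncomputable def weightedPower (p n : ℕ) (m : Pt d → ℕ) : ℝ≥0∞ :=
  ∑' y, (m y : ℝ≥0∞) * (h y ^ (p + 1) * factorialPower h n (removePt m y))

theorem weightedPower_zero_left (n : ℕ) (m : Pt d → ℕ) :
    weightedPower h 0 n m = factorialPower h (n + 1) m := by
  simp [weightedPower, factorialPower_succ]

theorem weightedPower_zero_right (p : ℕ) (m : Pt d → ℕ) :
    weightedPower h p 0 m = ∑' y, (m y : ℝ≥0∞) * h y ^ (p + 1) := by
  simp [weightedPower, factorialPower_zero]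

/-- A Newton-type identity: the point `y` of the power sum either differs from all points of the
tuple or coincides with one of its `n + 1` entries, raising the exponent there by one. -/
theorem mul_factorialPower_eq (p n : ℕ) (m : Pt d → ℕ) :
    (∑' y, (m y : ℝ≥0∞) * h y ^ (p + 1)) * factorialPower h (n + 1) m
      = weightedPower h p (n + 1) m + (n + 1) * weightedPower h (p + 1) n m := by
  rw [weightedPower, weightedPower, ← ENNReal.tsum_mul_right, ← ENNReal.tsum_mul_left,
    ← ENNReal.tsum_add]
  refine tsum_congr fun y => ?_
  by_cases hy : m y = 0
  · simp [hy]
  · conv_lhs => rw [← addPt_removePt hy, factorialPower_addPt, addPt_removePt hy]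
    ring

theorem weightedPower_le {p n : ℕ} {m : Pt d → ℕ} (h1 : ∀ x, h x ≤ 1) :
    weightedPower h p n m ≤ (∑' x, (m x : ℝ≥0∞) * h x) ^ (n + 1) := by
  refine le_trans ?_ (factorialPower_le h (n + 1) m)
  rw [factorialPower_succ]
  refine ENNReal.tsum_le_tsum fun y => ?_
  gcongr
  rw [pow_succ]
  exact mul_le_of_le_one_left zero_le (pow_le_one₀ zero_le (h1 y))

/-- Solving the Newton-type identity for the term with larger `n` expresses everything through power
sums, by induction on `n` for all exponents at once. -/
theorem measurable_factorialPower {Ω : Type*} [MeasurableSpace Ω] {M : Ω → Pt d → ℕ}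
    (h1 : ∀ x, h x ≤ 1) (hfin : ∀ ω, ∑' x, (M ω x : ℝ≥0∞) * h x ≠ ∞)
    (hmeas : ∀ p : ℕ, Measurable fun ω => ∑' x, (M ω x : ℝ≥0∞) * h x ^ (p + 1)) (n : ℕ) :
    Measurable fun ω => factorialPower h n (M ω) := by
  have hw : ∀ n p, Measurable fun ω => weightedPower h p n (M ω) := by
    intro n
    induction n with
    | zero => intro p; simpa only [weightedPower_zero_right] using hmeas p
    | succ n ih =>
      intro p
      have e : ∀ ω, weightedPower h p (n + 1) (M ω)
          = (∑' y, (M ω y : ℝ≥0∞) * h y ^ (p + 1)) * weightedPower h 0 n (M ω)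
            - (n + 1) * weightedPower h (p + 1) n (M ω) := by
        intro ω
        -- Subtraction in `ℝ≥0∞` is legitimate because the subtracted term is finite.
        rw [weightedPower_zero_left, mul_factorialPower_eq, ENNReal.add_sub_cancel_right]
        refine ENNReal.mul_ne_top (by finiteness) ?_
        exact ((weightedPower_le h h1).trans_lt (ENNReal.pow_lt_top (hfin ω).lt_top)).ne
      simp only [e]
      exact ((hmeas p).mul (ih 0)).sub ((ih (p + 1)).const_mul _)
  cases n with
  | zero => simp only [factorialPower_zero]; exact measurable_const
  | succ n => simpa only [weightedPower_zero_left] using hw n 0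

theorem factorialPower_count_ne_top (hh : ∀ x, h x ≠ ∞) (n : ℕ) (s : Multiset (Pt d)) :
    factorialPower h n (fun x => s.count x) ≠ ∞ := by
  refine ((factorialPower_le h n _).trans_lt (ENNReal.pow_lt_top ?_)).ne
  rw [tsum_eq_sum (s := s.toFinset) fun x hx => by
    rw [Multiset.count_eq_zero_of_notMem (by simpa using hx)]; simp]
  exact ENNReal.sum_lt_top.2 fun x _ => ENNReal.mul_lt_top (by simp) (hh x).lt_top

/-- This expands `∏ (1 - h(x))` with `h = 1 - e^{-f}`. Adding a point `a` multiplies the series by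
`1 - h(a) = e^{-f(a)}`, so induction on the multiset applies. -/
theorem hasSum_factorialPower_count (f : Pt d → ℝ) (hf : ∀ x, 0 ≤ f x) (s : Multiset (Pt d)) :
    HasSum (fun n : ℕ => (-1) ^ n / (n.factorial : ℝ) *
      (factorialPower (fun x => ENNReal.ofReal (1 - Real.exp (-f x))) n
        fun x => s.count x).toReal) (Real.exp (-(s.map f).sum)) := by
  set h : Pt d → ℝ≥0∞ := fun x => ENNReal.ofReal (1 - Real.exp (-f x)) with hh
  have htop := factorialPower_count_ne_top h fun x => ENNReal.ofReal_ne_top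
  induction s using Multiset.induction_on with
  | empty =>
    have e : ∀ n : ℕ, (-1) ^ n / (n.factorial : ℝ) *
        (factorialPower h n fun x => (0 : Multiset (Pt d)).count x).toReal
        = if n = 0 then 1 else 0 := by
      intro n
      cases n with
      | zero => simp [factorialPower_zero]
      | succ n => simp [factorialPower_succ]
    simp only [e]
    simpa using hasSum_ite_eq (0 : ℕ) (1 : ℝ)
  | cons a s ih =>
    have hcount : (fun x => (a ::ₘ s).count x) = addPt (fun x => s.count x) a := by
      funext x
      by_cases hx : x = a
      · subst hx; simp [addPt]
      · simp [addPt, hx]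
    -- The recursion concerns tuples of length `n + 1`; the term of length 0 is split off.
    rw [hcount, ← hasSum_nat_add_iff' 1]
    have h1 := (hasSum_nat_add_iff' 1).2 ih
    have h2 := h1.sub (ih.mul_left (1 - Real.exp (-f a)))
    have hah : (h a).toReal = 1 - Real.exp (-f a) :=
      ENNReal.toReal_ofReal (by linarith [Real.exp_le_one_iff.2 (neg_nonpos.2 (hf a))])
    convert h2 using 1
    · funext n
      rw [factorialPower_addPt, ENNReal.toReal_add (htop _ _)
        (ENNReal.mul_ne_top (ENNReal.mul_ne_top (by finiteness) ENNReal.ofReal_ne_top) (htop _ _)),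
        ENNReal.toReal_mul, ENNReal.toReal_mul, hah, Nat.factorial_succ,
        show ((n : ℝ≥0∞) + 1).toReal = n + 1 by
          rw [ENNReal.toReal_add (by finiteness) (by finiteness)]; simp]
      push_cast
      field_simp
      ring
    · simp only [Finset.range_one, Finset.sum_singleton, factorialPower_zero, Multiset.map_cons,
        Multiset.sum_cons, neg_add, Real.exp_add]
      ring

theorem hasSum_factorialPower {f : Pt d → ℝ} (hf : ∀ x, 0 ≤ f x) {m : Pt d → ℕ}
    (hm : {x | m x ≠ 0 ∧ f x ≠ 0}.Finite) :
    HasSum (fun n : ℕ => (-1) ^ n / (n.factorial : ℝ) *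
      (factorialPower (fun x => ENNReal.ofReal (1 - Real.exp (-f x))) n m).toReal)
      (Real.exp (-∑' x, (m x : ℝ) * f x)) := by
  let m' : Pt d →₀ ℕ := Finsupp.ofSupportFinite (fun x => if f x = 0 then 0 else m x)
    (hm.subset fun x hx => by
      simp only [Function.mem_support, ne_eq, ite_eq_left_iff, Classical.not_imp] at hx
      exact ⟨hx.2, hx.1⟩)
  have hm' : ∀ x, (Finsupp.toMultiset m').count x = if f x = 0 then 0 else m x := fun x => by
    rw [Finsupp.count_toMultiset]; rfl
  have key := hasSum_factorialPower_count f hf (Finsupp.toMultiset m')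
  have e₁ : ∀ n, factorialPower (fun x => ENNReal.ofReal (1 - Real.exp (-f x))) n
      (fun x => (Finsupp.toMultiset m').count x)
      = factorialPower (fun x => ENNReal.ofReal (1 - Real.exp (-f x))) n m := fun n =>
    factorialPower_congr _ (fun x hx => by
      have : f x ≠ 0 := fun h0 => hx (by simp [h0])
      rw [hm', if_neg this]) n
  have e₂ : ((Finsupp.toMultiset m').map f).sum = ∑' x, (m x : ℝ) * f x := by
    rw [Finset.sum_multiset_map_count, tsum_eq_sum (s := (Finsupp.toMultiset m').toFinset)]
    · refine Finset.sum_congr rfl fun x _ => ?_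
      rw [hm', nsmul_eq_mul]
      split_ifs with h0 <;> simp [h0]
    · intro x hx
      rw [Multiset.mem_toFinset, ← Multiset.count_eq_zero, hm'] at hx
      split_ifs at hx with h0 <;> simp [*]
  simpa only [e₁, e₂] using key

end FactorialSum

/-! ### Exponential functionals in terms of correlation functions -/

section ExponentialFunctionals

open scoped BoundedContinuousFunction

variable {d : ℕ}

/-- By convexity `(1 + |x|)^{d+1} ≤ 2^d (1 + |x|^{d+1})`, and `(1 + |x|)^{-(d+1)}` is integrable in
dimension `d`. -/
theorem integrable_psi (d : ℕ) : Integrable (psi : Pt d → ℝ) := by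
  have h := (integrable_one_add_norm (E := Pt d) (μ := volume) (r := d + 1)
    (by simp)).const_mul ((2 : ℝ) ^ d)
  refine h.mono' (continuous_psi d).aestronglyMeasurable (ae_of_all _ fun x => ?_)
  have h₁ := add_pow_le (zero_le_one' ℝ) (norm_nonneg x) (d + 1)
  rw [one_pow, Nat.add_sub_cancel] at h₁
  have h₂ : (1 + ‖x‖) ^ (-((d : ℝ) + 1)) = ((1 + ‖x‖) ^ (d + 1))⁻¹ := by
    rw [Real.rpow_neg (by positivity)]
    norm_cast
  rw [Real.norm_of_nonneg (psi_pos x).le, h₂, psi, psiA, one_mul, ← div_eq_mul_inv,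
    div_le_div_iff₀ (by positivity) (by positivity)]
  linarith

theorem integrable_mul_psi (g : Pt d →ᵇ ℝ) : Integrable fun x => g x * psi x :=
  (integrable_psi d).bdd_mul g.continuous.aestronglyMeasurable
    (ae_of_all _ fun x => g.norm_coe_le_norm x)

/-- The function `1 - e^{-g ψ}`. -/
noncomputable def oneSubExp (g : Pt d →ᵇ ℝ) (x : Pt d) : ℝ := 1 - Real.exp (-(g x * psi x))

section

variable {g : Pt d →ᵇ ℝ}

theorem continuous_oneSubExp (g : Pt d →ᵇ ℝ) : Continuous (oneSubExp g) := by
  have := continuous_psi d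
  unfold oneSubExp
  fun_prop

theorem oneSubExp_nonneg (hg : ∀ x, 0 ≤ g x) (x : Pt d) : 0 ≤ oneSubExp g x :=
  sub_nonneg.2 (Real.exp_le_one_iff.2 (neg_nonpos.2 (mul_nonneg (hg x) (psi_pos x).le)))

theorem oneSubExp_le_one (g : Pt d →ᵇ ℝ) (x : Pt d) : oneSubExp g x ≤ 1 :=
  sub_le_self _ (Real.exp_pos _).le

theorem oneSubExp_le (g : Pt d →ᵇ ℝ) (x : Pt d) : oneSubExp g x ≤ g x * psi x := by
  have := Real.one_sub_le_exp_neg (g x * psi x)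
  unfold oneSubExp
  linarith

theorem integrable_oneSubExp (hg : ∀ x, 0 ≤ g x) : Integrable (oneSubExp g) :=
  (integrable_mul_psi g).mono' (continuous_oneSubExp g).aestronglyMeasurable
    (ae_of_all _ fun x => by
      rw [Real.norm_of_nonneg (oneSubExp_nonneg hg x)]; exact oneSubExp_le g x)

theorem TemperedConfig.ofReal_sum (γ : TemperedConfig d) (hg : ∀ x, 0 ≤ g x) :
    ENNReal.ofReal (γ.sum fun x => g x * psi x)
      = ∑' x, (γ.mult x : ℝ≥0∞) * ENNReal.ofReal (g x * psi x) := by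
  rw [TemperedConfig.sum, ENNReal.ofReal_tsum_of_nonneg
    (fun x => mul_nonneg (Nat.cast_nonneg _) (mul_nonneg (hg x) (psi_pos x).le)) (γ.summable g)]
  refine tsum_congr fun x => ?_
  rw [ENNReal.ofReal_mul (Nat.cast_nonneg _), ENNReal.ofReal_natCast]

theorem tsum_mul_oneSubExp_ne_top (hg : ∀ x, 0 ≤ g x) (γ : TemperedConfig d) :
    ∑' x, (γ.mult x : ℝ≥0∞) * ENNReal.ofReal (oneSubExp g x) ≠ ∞ := by
  refine ne_top_of_le_ne_top (ENNReal.ofReal_ne_top (r := γ.sum fun x => g x * psi x)) ?_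
  rw [γ.ofReal_sum hg]
  gcongr
  exact oneSubExp_le g _

/-- The summand equals `q ψ` with `q` continuous and bounded by `‖g‖`, so the sum is one of the maps
that define the topology. -/
theorem measurable_tsum_mul_oneSubExp_pow (hg : ∀ x, 0 ≤ g x) (p : ℕ) :
    Measurable fun γ : TemperedConfig d =>
      ∑' x, (γ.mult x : ℝ≥0∞) * ENNReal.ofReal (oneSubExp g x) ^ (p + 1) := by
  have hc := continuous_oneSubExp g
  have hψ := continuous_psi d
  let q : Pt d →ᵇ ℝ := BoundedContinuousFunction.ofNormedAddCommGroup
    (fun x => oneSubExp g x ^ (p + 1) / psi x)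
    ((hc.pow _).div hψ fun x => (psi_pos x).ne') ‖g‖ fun x => by
      have h₀ := oneSubExp_nonneg hg x
      rw [Real.norm_of_nonneg (div_nonneg (pow_nonneg h₀ _) (psi_pos x).le),
        div_le_iff₀ (psi_pos x), pow_succ]
      calc oneSubExp g x ^ p * oneSubExp g x ≤ oneSubExp g x :=
            mul_le_of_le_one_left h₀ (pow_le_one₀ h₀ (oneSubExp_le_one g x))
        _ ≤ g x * psi x := oneSubExp_le g x
        _ ≤ ‖g‖ * psi x := (le_abs_self _).trans (abs_mul_psi_le g x)
  have hq : ∀ x, q x * psi x = oneSubExp g x ^ (p + 1) := fun x => by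
    change oneSubExp g x ^ (p + 1) / psi x * psi x = _
    rw [div_mul_cancel₀ _ (psi_pos x).ne']
  have hq0 : ∀ x, 0 ≤ q x := fun x =>
    div_nonneg (pow_nonneg (oneSubExp_nonneg hg x) _) (psi_pos x).le
  have e : ∀ γ : TemperedConfig d,
      ∑' x, (γ.mult x : ℝ≥0∞) * ENNReal.ofReal (oneSubExp g x) ^ (p + 1)
        = ENNReal.ofReal (γ.sum fun x => q x * psi x) := fun γ => by
    rw [γ.ofReal_sum hq0]
    simp only [hq, ENNReal.ofReal_pow (oneSubExp_nonneg hg _)]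
  simp only [e]
  exact (continuous_sum q).measurable.ennreal_ofReal

theorem measurable_factorialPower_oneSubExp (hg : ∀ x, 0 ≤ g x) (n : ℕ) :
    Measurable fun γ : TemperedConfig d =>
      factorialPower (fun x => ENNReal.ofReal (oneSubExp g x)) n γ.mult :=
  measurable_factorialPower _ (fun x => ENNReal.ofReal_le_one.2 (oneSubExp_le_one g x))
    (tsum_mul_oneSubExp_ne_top hg) (measurable_tsum_mul_oneSubExp_pow hg) n

theorem integrable_prod_oneSubExp (hg : ∀ x, 0 ≤ g x) (n : ℕ) :
    Integrable fun x : Fin n → Pt d => ∏ j, oneSubExp g (x j) :=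
  Integrable.fintype_prod fun _ => integrable_oneSubExp hg

theorem integral_prod_oneSubExp (g : Pt d →ᵇ ℝ) (n : ℕ) :
    ∫ x : Fin n → Pt d, ∏ j, oneSubExp g (x j) = (∫ x, oneSubExp g x) ^ n := by
  rw [integral_fintype_prod_volume_eq_pow (oneSubExp g), Fintype.card_fin]

variable {ϑ : ℝ} {μ : Measure (TemperedConfig d)} {k : FinFun d}

theorem IsCorrelationFunction.isBoundedFun (hk : IsCorrelationFunction μ k)
    (hb : ∀ n x, k n x ≤ Real.exp (ϑ * n)) : IsBoundedFun ϑ k :=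
  ⟨hk.measurable, fun n x => by rw [abs_of_nonneg (hk.nonneg n x)]; exact hb n x⟩

theorem lintegral_factorialPower (hk : IsCorrelationFunction μ k)
    (hb : ∀ n x, k n x ≤ Real.exp (ϑ * n)) (hg : ∀ x, 0 ≤ g x) (n : ℕ) :
    ∫⁻ γ, factorialPower (fun x => ENNReal.ofReal (oneSubExp g x)) n γ.mult ∂μ
      = ENNReal.ofReal (∫ x : Fin n → Pt d, k n x * ∏ j, oneSubExp g (x j)) := by
  have hm : Measurable fun x : Fin n → Pt d => ∏ j, ENNReal.ofReal (oneSubExp g (x j)) :=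
    Finset.measurable_fun_prod _ fun j _ =>
      ((continuous_oneSubExp g).measurable.comp (measurable_pi_apply j)).ennreal_ofReal
  have h0 : ∀ x : Fin n → Pt d, 0 ≤ ∏ j, oneSubExp g (x j) := fun x =>
    Finset.prod_nonneg fun j _ => oneSubExp_nonneg hg _
  simp only [factorialPower]
  rw [hk.density n _ hm, ofReal_integral_eq_lintegral_ofReal
    ((hk.isBoundedFun hb).integrable_mul (integrable_prod_oneSubExp hg n))
    (ae_of_all _ fun x => mul_nonneg (hk.nonneg n x) (h0 x))]
  refine lintegral_congr fun x => ?_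
  rw [mul_comm, ENNReal.ofReal_mul (hk.nonneg n x),
    ENNReal.ofReal_prod_of_nonneg fun j _ => oneSubExp_nonneg hg _]

theorem integral_toReal_factorialPower (hk : IsCorrelationFunction μ k)
    (hb : ∀ n x, k n x ≤ Real.exp (ϑ * n)) (hg : ∀ x, 0 ≤ g x) (n : ℕ) :
    Integrable (fun γ : TemperedConfig d =>
      (factorialPower (fun x => ENNReal.ofReal (oneSubExp g x)) n γ.mult).toReal) μ ∧
    ∫ γ, (factorialPower (fun x => ENNReal.ofReal (oneSubExp g x)) n γ.mult).toReal ∂μ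
      = ∫ x : Fin n → Pt d, k n x * ∏ j, oneSubExp g (x j) := by
  have hm := measurable_factorialPower_oneSubExp hg n
  have hl := lintegral_factorialPower hk hb hg n
  have hne : ∫⁻ γ, factorialPower (fun x => ENNReal.ofReal (oneSubExp g x)) n γ.mult ∂μ ≠ ∞ := by
    rw [hl]; exact ENNReal.ofReal_ne_top
  refine ⟨integrable_toReal_of_lintegral_ne_top hm.aemeasurable hne, ?_⟩
  rw [integral_toReal hm.aemeasurable (ae_lt_top hm hne), hl, ENNReal.toReal_ofReal]
  exact integral_nonneg fun x => mul_nonneg (hk.nonneg n x)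
    (Finset.prod_nonneg fun j _ => oneSubExp_nonneg hg _)

/-- The function `∏_{x ∈ η} (e^{-g(x) ψ(x)} - 1)` of finite configurations. -/
noncomputable def expFun (g : Pt d →ᵇ ℝ) : FinFun d :=
  fun n x => (-1) ^ n * ∏ j, oneSubExp g (x j)

theorem measurable_expFun (g : Pt d →ᵇ ℝ) (n : ℕ) : Measurable (expFun g n) :=
  (Finset.measurable_fun_prod _ fun j _ =>
    (continuous_oneSubExp g).measurable.comp (measurable_pi_apply j)).const_mul _

theorem gNorm_expFun_lt_top (ϑ : ℝ) (hg : ∀ x, 0 ≤ g x) : gNorm ϑ (expFun g) < ∞ := by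
  have e : ∀ n : ℕ, ENNReal.ofReal (Real.exp (ϑ * n) / (n.factorial : ℝ)) *
      eLpNorm (expFun g n) 1 volume
      = ENNReal.ofReal ((Real.exp ϑ * ∫ x, oneSubExp g x) ^ n / n.factorial) := by
    intro n
    have hn : ∀ x : Fin n → Pt d, ‖expFun g n x‖ = ∏ j, oneSubExp g (x j) := fun x => by
      rw [expFun, norm_mul, norm_pow, norm_neg, norm_one, one_pow, one_mul,
        Real.norm_of_nonneg (Finset.prod_nonneg fun j _ => oneSubExp_nonneg hg _)]
    have hi : Integrable (expFun g n) := (integrable_prod_oneSubExp hg n).const_mul _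
    rw [eLpNorm_one_eq_lintegral_enorm, ← ofReal_integral_norm_eq_lintegral_enorm hi, ← ENNReal.ofReal_mul (by positivity)]
    simp only [hn]
    rw [integral_prod_oneSubExp, mul_pow, ← Real.exp_nat_mul, mul_comm ϑ]
    ring_nf
  unfold gNorm
  simp only [e]
  exact (Real.summable_pow_div_factorial _).tsum_ofReal_lt_top

/-- Compact support leaves finitely many relevant points, so the product expansion holds for each
configuration. Its terms have `L^1` norms bounded by those of an exponential series, which permits
integration term by term. -/
theorem integral_exp_neg_sum_of_support [IsProbabilityMeasure μ] (hk : IsCorrelationFunction μ k)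
    (hb : ∀ n x, k n x ≤ Real.exp (ϑ * n)) (hg : ∀ x, 0 ≤ g x) {K : Set (Pt d)}
    (hK : IsCompact K) (hgK : ∀ x ∉ K, g x = 0) :
    ∫ γ, Real.exp (-TemperedConfig.sum γ fun x => g x * psi x) ∂μ = pairing k (expFun g) := by
  have hsum : ∀ γ : TemperedConfig d, HasSum (fun n : ℕ => (-1) ^ n / (n.factorial : ℝ) *
      (factorialPower (fun x => ENNReal.ofReal (oneSubExp g x)) n γ.mult).toReal)
      (Real.exp (-γ.sum fun x => g x * psi x)) := fun γ =>
    hasSum_factorialPower (fun x => mul_nonneg (hg x) (psi_pos x).le)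
      ((γ.locallyFinite K hK).subset fun x hx => ⟨by
        by_contra hxK
        exact hx.2 (by rw [hgK x hxK, zero_mul]), hx.1⟩)
  have hint := integral_toReal_factorialPower hk hb hg
  have hpos : ∀ n, 0 ≤ ∫ x : Fin n → Pt d, k n x * ∏ j, oneSubExp g (x j) := fun n =>
    integral_nonneg fun x => mul_nonneg (hk.nonneg n x)
      (Finset.prod_nonneg fun j _ => oneSubExp_nonneg hg _)
  have hnorm : ∀ n : ℕ, ∫ γ, ‖(-1) ^ n / (n.factorial : ℝ) *
      (factorialPower (fun x => ENNReal.ofReal (oneSubExp g x)) n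
        (TemperedConfig.toConfig γ).mult).toReal‖ ∂μ
      ≤ (Real.exp ϑ * ∫ x, oneSubExp g x) ^ n / n.factorial := by
    intro n
    have e : ∀ γ : TemperedConfig d, ‖(-1) ^ n / (n.factorial : ℝ) *
      (factorialPower (fun x => ENNReal.ofReal (oneSubExp g x)) n γ.mult).toReal‖
      = 1 / (n.factorial : ℝ) *
        (factorialPower (fun x => ENNReal.ofReal (oneSubExp g x)) n γ.mult).toReal := fun γ => by
      rw [norm_mul, norm_div, norm_pow, norm_neg, norm_one, one_pow,
        Real.norm_of_nonneg ENNReal.toReal_nonneg, Real.norm_of_nonneg (Nat.cast_nonneg _)]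
    simp only [e]
    rw [integral_const_mul, (hint n).2, div_mul_eq_mul_div, one_mul]
    gcongr
    have := (le_abs_self _).trans ((hk.isBoundedFun hb).abs_integral_mul_le
      (integrable_prod_oneSubExp hg n))
    simp only [abs_of_nonneg (Finset.prod_nonneg fun j _ => oneSubExp_nonneg hg _)] at this
    rwa [integral_prod_oneSubExp, mul_comm ϑ, Real.exp_nat_mul, ← mul_pow] at this
  have key := hasSum_integral_of_summable_integral_norm (μ := μ)
    (F := fun (n : ℕ) (γ : TemperedConfig d) => (-1) ^ n / (n.factorial : ℝ) *
      (factorialPower (fun x => ENNReal.ofReal (oneSubExp g x)) n γ.mult).toReal)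
    (fun n => (hint n).1.const_mul _)
    (Summable.of_nonneg_of_le (fun n => integral_nonneg fun _ => norm_nonneg _) hnorm
      (Real.summable_pow_div_factorial _))
  simp only [(hsum _).tsum_eq] at key
  rw [← key.tsum_eq, pairing]
  refine tsum_congr fun n => ?_
  rw [integral_const_mul, (hint n).2]
  simp only [expFun, mul_left_comm _ ((-1 : ℝ) ^ n)]
  rw [integral_const_mul]
  ring

theorem lintegral_tsum_mul_le (hk : IsCorrelationFunction μ k)
    (hb : ∀ n x, k n x ≤ Real.exp (ϑ * n)) {u : Pt d → ℝ≥0∞} (hu : Measurable u) :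
    ∫⁻ γ, ∑' x, ((TemperedConfig.toConfig γ).mult x : ℝ≥0∞) * u x ∂μ
      ≤ ENNReal.ofReal (Real.exp ϑ) * ∫⁻ x, u x := by
  have h := hk.density 1 (fun x => u (x 0)) (hu.comp (measurable_pi_apply 0))
  simp only [factorialSum, Fin.cons_zero] at h
  rw [h]
  have e := (volume_preserving_funUnique (Fin 1) (Pt d)).lintegral_comp hu
  have hm : Measurable fun x => u (MeasurableEquiv.funUnique (Fin 1) (Pt d) x) :=
    hu.comp (MeasurableEquiv.measurable _)
  rw [← e, ← lintegral_const_mul _ hm]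
  refine lintegral_mono fun x => ?_
  have hx := ENNReal.ofReal_le_ofReal (hb 1 x)
  rw [Nat.cast_one, mul_one] at hx
  rw [mul_comm]
  exact mul_le_mul_left hx _

/-- With `A, B ≥ 0` one has `|e^{-A-B} - e^{-A}| ≤ B`; here `B` is the sum over the removed part of
`g`, and its mean is bounded through the first correlation function. The bound involves the state
only through `ϑ`. -/
theorem abs_integral_exp_sub_le [IsProbabilityMeasure μ] (hk : IsCorrelationFunction μ k)
    (hb : ∀ n x, k n x ≤ Real.exp (ϑ * n)) (hg : ∀ x, 0 ≤ g x) (j : ℕ) :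
    |(∫ γ, Real.exp (-TemperedConfig.sum γ fun x => g x * psi x) ∂μ)
      - ∫ γ, Real.exp (-TemperedConfig.sum γ fun x => (g * cutoff d j) x * psi x) ∂μ|
      ≤ Real.exp ϑ * ∫ x, (1 - cutoff d j x) * (g x * psi x) := by
  set g' : Pt d →ᵇ ℝ := g - g * cutoff d j with hg'
  have hg'x : ∀ x, g' x * psi x = (1 - cutoff d j x) * (g x * psi x) := fun x => by
    simp only [hg', BoundedContinuousFunction.sub_apply, BoundedContinuousFunction.mul_apply]
    ring
  have hg'0 : ∀ x, 0 ≤ g' x := fun x => by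
    simp only [hg', BoundedContinuousFunction.sub_apply, BoundedContinuousFunction.mul_apply]
    exact sub_nonneg.2 (mul_le_of_le_one_right (hg x) (cutoff_le_one j x))
  have hgc0 : ∀ x, 0 ≤ (g * cutoff d j) x := fun x => mul_nonneg (hg x) (cutoff_nonneg j x)
  have hsplit : ∀ γ : TemperedConfig d, (γ.sum fun x => g x * psi x)
      = (γ.sum fun x => (g * cutoff d j) x * psi x) + γ.sum fun x => g' x * psi x := fun γ => by
    rw [← TemperedConfig.sum_add, hg', add_sub_cancel]
  have hexp : ∀ q : Pt d →ᵇ ℝ, (∀ x, 0 ≤ q x) →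
      Integrable (fun γ : TemperedConfig d => Real.exp (-γ.sum fun x => q x * psi x)) μ :=
    fun q hq => Integrable.of_bound
      ((continuous_sum q).neg.rexp.measurable.aestronglyMeasurable) 1 (ae_of_all _ fun γ => by
        rw [Real.norm_of_nonneg (Real.exp_pos _).le]
        exact Real.exp_le_one_iff.2 (neg_nonpos.2 (γ.sum_nonneg fun x =>
          mul_nonneg (hq x) (psi_pos x).le)))
  have hle : ∫⁻ γ : TemperedConfig d, ENNReal.ofReal (γ.sum fun x => g' x * psi x) ∂μ
      ≤ ENNReal.ofReal (Real.exp ϑ * ∫ x, (1 - cutoff d j x) * (g x * psi x)) := by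
    have h₁ := lintegral_tsum_mul_le hk hb (u := fun x => ENNReal.ofReal (g' x * psi x))
      ((g'.continuous.mul (continuous_psi d)).measurable.ennreal_ofReal)
    simp only [← TemperedConfig.ofReal_sum _ hg'0] at h₁
    rw [← ofReal_integral_eq_lintegral_ofReal (integrable_mul_psi g')
      (ae_of_all _ fun x => mul_nonneg (hg'0 x) (psi_pos x).le),
      ← ENNReal.ofReal_mul (Real.exp_pos _).le] at h₁
    simpa only [hg'x] using h₁
  have hr0 : 0 ≤ Real.exp ϑ * ∫ x, (1 - cutoff d j x) * (g x * psi x) := by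
    refine mul_nonneg (Real.exp_pos _).le (integral_nonneg fun x => ?_)
    rw [← hg'x]
    exact mul_nonneg (hg'0 x) (psi_pos x).le
  rw [← integral_sub (hexp g hg) (hexp _ hgc0), ← Real.norm_eq_abs]
  refine (norm_integral_le_lintegral_norm _).trans (ENNReal.toReal_le_of_le_ofReal hr0
    (le_trans (lintegral_mono fun γ => ENNReal.ofReal_le_ofReal ?_) hle))
  have h₁ : 0 ≤ γ.sum fun x => (g * cutoff d j) x * psi x :=
    γ.sum_nonneg fun x => mul_nonneg (hgc0 x) (psi_pos x).le
  have h₂ : 0 ≤ γ.sum fun x => g' x * psi x :=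
    γ.sum_nonneg fun x => mul_nonneg (hg'0 x) (psi_pos x).le
  rw [hsplit, neg_add, Real.exp_add, ← mul_sub_one, norm_mul, Real.norm_of_nonneg (Real.exp_pos _).le,
    Real.norm_eq_abs, abs_sub_comm, abs_of_nonneg (sub_nonneg.2 (Real.exp_le_one_iff.2
      (neg_nonpos.2 h₂)))]
  have h₃ := Real.one_sub_le_exp_neg (γ.sum fun x => g' x * psi x)
  have h₄ : Real.exp (-γ.sum fun x => (g * cutoff d j) x * psi x) ≤ 1 :=
    Real.exp_le_one_iff.2 (neg_nonpos.2 h₁)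
  refine (mul_le_of_le_one_left ?_ h₄).trans (by linarith)
  exact sub_nonneg.2 (Real.exp_le_one_iff.2 (neg_nonpos.2 h₂))

theorem tendsto_integral_one_sub_cutoff (g : Pt d →ᵇ ℝ) :
    Tendsto (fun j => ∫ x, (1 - cutoff d j x) * (g x * psi x)) atTop (𝓝 0) := by
  have : Tendsto (fun j => ∫ x, (1 - cutoff d j x) * (g x * psi x)) atTop
      (𝓝 (∫ _ : Pt d, (0 : ℝ))) := by
    refine tendsto_integral_of_dominated_convergence (fun x => |g x * psi x|) (fun j => ?_)
      (integrable_mul_psi g).abs (fun j => ae_of_all _ fun x => ?_) (ae_of_all _ fun x => ?_)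
    · exact ((continuous_const.sub (cutoff d j).continuous).mul
        (g.continuous.mul (continuous_psi d))).aestronglyMeasurable
    · rw [norm_mul, Real.norm_of_nonneg (sub_nonneg.2 (cutoff_le_one j x)), Real.norm_eq_abs]
      exact mul_le_of_le_one_left (abs_nonneg _) (sub_le_self _ (cutoff_nonneg j x))
    · simpa using ((tendsto_cutoff x).const_sub 1).mul_const (g x * psi x)
  simpa using this

end

/-! ### Weak convergence of the states -/

variable {a φ : Pt d → ℝ} {ϑ₀ : ℝ} {μ₀ : ProbabilityMeasure (TemperedConfig d)}
  {μ : ℝ → ℝ → ProbabilityMeasure (TemperedConfig d)} {k : ℝ → ℝ → FinFun d}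

theorem tendsto_integral_exp_neg_sum (h : ModelAssumptions a φ)
    (hμ : ∀ α ∈ Icc (0 : ℝ) 1, IsStateEvolution a φ α ϑ₀ μ₀ (μ α) (k α))
    {t : ℝ} (ht : 0 ≤ t) {g : Pt d →ᵇ ℝ} (hg : ∀ x, 0 ≤ g x) :
    Tendsto (fun α => ∫ γ : TemperedConfig d, Real.exp (-γ.sum fun x => g x * psi x) ∂(μ α t))
      (𝓝[>] 0) (𝓝 (∫ γ : TemperedConfig d, Real.exp (-γ.sum fun x => g x * psi x) ∂(μ 0 t))) := by
  have h0 : (0 : ℝ) ∈ Icc (0 : ℝ) 1 := by simp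
  have hcut : ∀ j, Tendsto (fun α => ∫ γ : TemperedConfig d,
      Real.exp (-γ.sum fun x => (g * cutoff d j) x * psi x) ∂(μ α t)) (𝓝[>] 0)
      (𝓝 (∫ γ : TemperedConfig d,
        Real.exp (-γ.sum fun x => (g * cutoff d j) x * psi x) ∂(μ 0 t))) := by
    intro j
    have hgc0 : ∀ x, 0 ≤ (g * cutoff d j) x := fun x => mul_nonneg (hg x) (cutoff_nonneg j x)
    have e : ∀ α ∈ Icc (0 : ℝ) 1, ∫ γ : TemperedConfig d,
        Real.exp (-γ.sum fun x => (g * cutoff d j) x * psi x) ∂(μ α t)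
        = pairing (k α t) (expFun (g * cutoff d j)) := fun α hα =>
      integral_exp_neg_sum_of_support ((hμ α hα).correlation t ht) ((hμ α hα).bound t ht) hgc0
        (isCompact_closedBall 0 (j : ℝ)) fun x hx => by
          rw [BoundedContinuousFunction.mul_apply, cutoff_eq_zero hx, mul_zero]
    rw [e 0 h0]
    refine (tendsto_pairing h hμ ht le_rfl (measurable_expFun _)
      (gNorm_expFun_lt_top (ϑ₀ + t) hgc0)).congr' ?_
    filter_upwards [eventually_mem_Icc] with α hα
    exact (e α hα).symm
  rw [Metric.tendsto_nhds]
  intro ε hε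
  have hlim := (tendsto_integral_one_sub_cutoff g).const_mul (Real.exp (ϑ₀ + t))
  rw [mul_zero] at hlim
  -- The cutoff is chosen before `α`: all the states at time `t` share the same bound on the
  -- correlation functions.
  obtain ⟨j, hj⟩ := (hlim.eventually_lt_const (show 0 < ε / 3 by positivity)).exists
  filter_upwards [eventually_mem_Icc, Metric.tendsto_nhds.1 (hcut j) (ε / 3) (by positivity)]
    with α hα hαj
  rw [Real.dist_eq] at hαj ⊢
  have h₁ := abs_lt.1 ((abs_integral_exp_sub_le ((hμ α hα).correlation t ht)
    ((hμ α hα).bound t ht) hg j).trans_lt hj)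
  have h₂ := abs_lt.1 ((abs_integral_exp_sub_le ((hμ 0 h0).correlation t ht)
    ((hμ 0 h0).bound t ht) hg j).trans_lt hj)
  have h₃ := abs_lt.1 hαj
  rw [abs_lt]
  constructor <;> linarith [h₁.1, h₁.2, h₂.1, h₂.2, h₃.1, h₃.2]

end ExponentialFunctionals

end RepulsiveJumps

open RepulsiveJumps
theorem mainTheorem8 (d : ℕ) (hd : 1 ≤ d) (a φ : Pt d → ℝ) (hmodel : ModelAssumptions a φ)
    (ϑ₀ : ℝ) (μ₀ : ProbabilityMeasure (TemperedConfig d))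
    (hμ₀ : IsSubPoissonian ϑ₀ (μ₀ : Measure (TemperedConfig d)))
    (μ : ℝ → ℝ → ProbabilityMeasure (TemperedConfig d)) (k : ℝ → ℝ → FinFun d)
    (hμ : ∀ α ∈ Icc (0 : ℝ) 1, IsStateEvolution a φ α ϑ₀ μ₀ (μ α) (k α))
    (t : ℝ) (ht : 0 < t) :
    Tendsto (fun α => μ α t) (𝓝[>] 0) (𝓝 (μ 0 t)) ∧
      ∃ ϑ : ℝ, ϑ₀ + t < ϑ ∧ ∀ G : FinFun d, IsFinFun G → gNorm ϑ G < ∞ →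
        Tendsto (fun α => pairing (k α t) G) (𝓝[>] 0) (𝓝 (pairing (k 0 t) G)) := by
  -- Every exponent at least `ϑ₀ + t` works for the pairings; adding 1 only makes the inequality
  -- strict.
  refine ⟨tendsto_of_tendsto_integral_exp fun g hg =>
    tendsto_integral_exp_neg_sum hmodel hμ ht.le hg, ϑ₀ + t + 1, lt_add_one _, fun G hG hGn => ?_⟩
  exact tendsto_pairing hmodel hμ ht.le (lt_add_one _).le hG.measurable hGn
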